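/- Let $\mathcal N=\{1,\dots,n\}$ be a set of products. A marginal distribution model (MDM) is given by deterministic utilities $\nu_1,\dots,\nu_n\in\mathbb R$ and probability distributions $F_1,\dots,F_n$ on $\mathbb R$, each absolutely continuous, with distribution function strictly increasing on its support, and with finite first absolute moment. For a nonempty assortment $S\subseteq\mathcal N$, its choice probabilities are $p_{i,S}=\mathbb P_{\theta^*}\big(i=\arg\max_{j\in S}(\nu_j+\tilde\epsilon_j)\big)$, $i\in S$, where $\theta^*$ maximizes $\mathbb E_\theta[\max_{j\in S}(\nu_j+\tilde\epsilon_j)]$ over all joint distributions $\theta$ of $(\tilde\epsilon_1,\dots,\tilde\epsilon_n)$ with marginals $F_1,\dots,F_n$. For a collection $\mathcal S$ of assortments let $\mathcal I_{\mathcal S}=\{(i,S): i\in S,\ S\in\mathcal S\}$ and let $\mathcal P_{\rm mdm}(\mathcal S)\subseteq\mathbb R^{\mathcal I_{\mathcal S}}$ be the set of all choice probability collections $(p_{i,S})_{(i,S)\in\mathcal I_{\mathcal S}}$ that arise from a single MDM. Let $\boldsymbol p_{\mathcal S}\in\mathcal P_{\rm mdm}(\mathcal S)$, let $A\subseteq\mathcal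 N$ be a nonempty assortment with $A\notin\mathcal S$, and let $r_i\in(0,\infty)$ for $i\in\mathcal N$. Put $\mathcal U_A=\{\boldsymbol x_A=(x_{i,A})_{i\in A}: (\boldsymbol p_{\mathcal S},\boldsymbol x_A)\in\mathcal P_{\rm mdm}(\mathcal S\cup\{A\})\}$ and $$\underline r(A)=\inf_{\boldsymbol x_A\in\mathcal U_A}\sum_{i\in A}r_ix_{i,A},\qquad \bar r(A)=\sup_{\boldsymbol x_A\in\mathcal U_A}\sum_{i\in A}r_ix_{i,A}.$$ Then $\mathcal U_A$ is nonempty, both values are finite, and for every $\epsilon$ with $0<\epsilon<1/(2|\mathcal S|)$ (every $\epsilon>0$ if $\mathcal S=\emptyset$), $\underline r(A)$ equals the optimal value, which is attained, of the mixed integer linear program in the variables $x_{i,A}$ $(i\in A)$, $\lambda_S$ $(S\in\mathcal S)$, $\lambda_A$, $\delta_{A,S},\delta_{S,A}$ $(S\in\mathcal S)$: $$\begin{aligned} \min\ & \sum_{i\in A}r_ix_{i,A}\\ \text{s.t. } & -\delta_{A,S}\le\lambda_A-\lambda_S\le 1-(1+\epsilon)\delta_{A,S}, && i\in A,\ (i,S)\in\mathcal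 I_{\mathcal S},\\ & -\delta_{S,A}\le\lambda_S-\lambda_A\le 1-(1+\epsilon)\delta_{S,A}, && i\in A,\ (i,S)\in\mathcal I_{\mathcal S},\\ & \delta_{A,S}-1\le x_{i,A}-p_{i,S}\le 1-\delta_{S,A}, && i\in A,\ (i,S)\in\mathcal I_{\mathcal S},\\ & -(\delta_{A,S}+\delta_{S,A})\le x_{i,A}-p_{i,S}\le\delta_{A,S}+\delta_{S,A}, && i\in A,\ (i,S)\in\mathcal I_{\mathcal S},\\ & \lambda_S-\lambda_T\ge\epsilon, && (i,S),(i,T)\in\mathcal I_{\mathcal S},\ p_{i,S}<p_{i,T},\\ & \lambda_S-\lambda_T=0, && (i,S),(i,T)\in\mathcal I_{\mathcal S},\ p_{i,S}=p_{i,T}\ne0,\\ & \textstyle\sum_{i\in A}x_{i,A}=1,\quad x_{i,A}\ge0, && i\in A,\\ & 0\le\lambda_A\le1,\quad 0\le\lambda_S\le1,\quad \delta_{A,S},\delta_{S,A}\in\{0,1\}, && S\in\mathcal S. \end{aligned}$$ Likewise, $\bar r(A)$ equals the optimal value, which is attained, of the problem of maximizing $\sum_{i\in A}r_ix_{i,A}$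 over the same constraints. -/

import Mathlib

open MeasureTheory ProbabilityTheory

noncomputable section

/-- A marginal law of a random utility term: absolutely continuous, with a distribution function
that is strictly increasing on its support, and with a finite first absolute moment. -/
structure IsMDMMarginal (μ : Measure ℝ) : Prop where
  prob : IsProbabilityMeasure μ
  absCont : μ ≪ volume
  strictMono : StrictMonoOn (cdf μ) μ.support
  integrable : Integrable (fun t : ℝ => t) μ

/-- The set of all joint laws on `ℝⁿ` with the given one-dimensional marginals. -/
def jointLaws {n : ℕ} (μ : Fin n → Measure ℝ) : Set (Measure (Fin n → ℝ)) :=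
  {θ | IsProbabilityMeasure θ ∧ ∀ i, θ.map (fun e => e i) = μ i}

/-- Expected maximal utility `𝔼_θ [max_{i ∈ S} (ν_i + ε_i)]` offered by the assortment `S`. -/
def expectedMaxUtility {n : ℕ} (ν : Fin n → ℝ) (S : Finset (Fin n)) (hS : S.Nonempty)
    (θ : Measure (Fin n → ℝ)) : ℝ :=
  ∫ e, S.sup' hS (fun i => ν i + e i) ∂θ

/-- The event that product `i` maximizes the utility over the assortment `S`. -/
def argmaxEvent {n : ℕ} (ν : Fin n → ℝ) (S : Finset (Fin n)) (i : Fin n) : Set (Fin n → ℝ) :=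
  {e | ∀ j ∈ S, ν j + e j ≤ ν i + e i}

/-- `x` (through its entries `x i`, `i ∈ S`) is the vector of choice probabilities for the
assortment `S` under the marginal distribution model with deterministic utilities `ν` and
marginals `μ`: it is evaluated under a joint law that attains the maximal expected utility among
all joint laws with the given marginals. -/
def IsMDMChoice {n : ℕ} (ν : Fin n → ℝ) (μ : Fin n → Measure ℝ) (S : Finset (Fin n))
    (x : Fin n → ℝ) : Prop :=
  ∃ hS : S.Nonempty, ∃ θ ∈ jointLaws μ, IsMaxOn (expectedMaxUtility ν S hS) (jointLaws μ) θ ∧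
    ∀ i ∈ S, x i = θ.real (argmaxEvent ν S i)

/-- The choice probability collections over the assortment collection `𝒮` that are representable
by a marginal distribution model; `p S i` is the probability of choosing `i` out of `S`, and only
the entries with `S ∈ 𝒮`, `i ∈ S` matter. A single pair `(ν, μ)` has to serve all assortments. -/
def mdmProbs {n : ℕ} (𝒮 : Finset (Finset (Fin n))) : Set (Finset (Fin n) → Fin n → ℝ) :=
  {p | ∃ (ν : Fin n → ℝ) (μ : Fin n → Measure ℝ),
    (∀ i, IsMDMMarginal (μ i)) ∧ ∀ S ∈ 𝒮, IsMDMChoice ν μ S (p S)}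

/-- The choice vectors `x_A` for a new assortment `A` that are consistent with the data `p` over
`𝒮`: the collection `(p, x_A)` over `𝒮 ∪ {A}` is representable. -/
def consistentChoices {n : ℕ} (𝒮 : Finset (Finset (Fin n))) (p : Finset (Fin n) → Fin n → ℝ)
    (A : Finset (Fin n)) : Set (Fin n → ℝ) :=
  {x | Function.update p A x ∈ mdmProbs (insert A 𝒮)}

/-- Expected revenue of the assortment `A` under the choice vector `x`. -/
def revenue {n : ℕ} (r : Fin n → ℝ) (A : Finset (Fin n)) (x : Fin n → ℝ) : ℝ :=
  ∑ i ∈ A, r i * x i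

/-- The expected revenues of `A` that are consistent with the data. -/
def consistentRevenues {n : ℕ} (𝒮 : Finset (Finset (Fin n))) (p : Finset (Fin n) → Fin n → ℝ)
    (A : Finset (Fin n)) (r : Fin n → ℝ) : Set ℝ :=
  revenue r A '' consistentChoices 𝒮 p A

/-- Worst-case expected revenue. -/
def worstCaseRevenue {n : ℕ} (𝒮 : Finset (Finset (Fin n))) (p : Finset (Fin n) → Fin n → ℝ)
    (A : Finset (Fin n)) (r : Fin n → ℝ) : ℝ :=
  sInf (consistentRevenues 𝒮 p A r)

/-- Optimistic expected revenue. -/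
def optimisticRevenue {n : ℕ} (𝒮 : Finset (Finset (Fin n))) (p : Finset (Fin n) → Fin n → ℝ)
    (A : Finset (Fin n)) (r : Fin n → ℝ) : ℝ :=
  sSup (consistentRevenues 𝒮 p A r)

/-- Variables of the mixed integer linear program: `x i` for `i ∈ A`, `lam S` for
`S ∈ 𝒮 ∪ {A}`, and the binary variables `dAS S` (for `δ_{A,S}`) and `dSA S` (for `δ_{S,A}`),
`S ∈ 𝒮`. Entries with other indices occur neither in the constraints nor in the objective. -/
structure MILPVars (n : ℕ) where
  x : Fin n → ℝ
  lam : Finset (Fin n) → ℝ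
  dAS : Finset (Fin n) → ℝ
  dSA : Finset (Fin n) → ℝ

/-- The constraints of the mixed integer linear program. -/
structure MILPFeasible {n : ℕ} (𝒮 : Finset (Finset (Fin n))) (p : Finset (Fin n) → Fin n → ℝ)
    (A : Finset (Fin n)) (ε : ℝ) (v : MILPVars n) : Prop where
  sign_AS : ∀ S ∈ 𝒮, ∀ i ∈ A, i ∈ S →
    -v.dAS S ≤ v.lam A - v.lam S ∧ v.lam A - v.lam S ≤ 1 - (1 + ε) * v.dAS S
  sign_SA : ∀ S ∈ 𝒮, ∀ i ∈ A, i ∈ S →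
    -v.dSA S ≤ v.lam S - v.lam A ∧ v.lam S - v.lam A ≤ 1 - (1 + ε) * v.dSA S
  prob_order : ∀ S ∈ 𝒮, ∀ i ∈ A, i ∈ S →
    v.dAS S - 1 ≤ v.x i - p S i ∧ v.x i - p S i ≤ 1 - v.dSA S
  prob_tie : ∀ S ∈ 𝒮, ∀ i ∈ A, i ∈ S →
    -(v.dAS S + v.dSA S) ≤ v.x i - p S i ∧ v.x i - p S i ≤ v.dAS S + v.dSA S
  data_lt : ∀ S ∈ 𝒮, ∀ T ∈ 𝒮, ∀ i ∈ S, i ∈ T → p S i < p T i → ε ≤ v.lam S - v.lam T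
  data_eq : ∀ S ∈ 𝒮, ∀ T ∈ 𝒮, ∀ i ∈ S, i ∈ T → p S i = p T i → p S i ≠ 0 →
    v.lam S - v.lam T = 0
  sum_one : ∑ i ∈ A, v.x i = 1
  x_nonneg : ∀ i ∈ A, 0 ≤ v.x i
  lam_A : 0 ≤ v.lam A ∧ v.lam A ≤ 1
  lam_S : ∀ S ∈ 𝒮, 0 ≤ v.lam S ∧ v.lam S ≤ 1
  binary : ∀ S ∈ 𝒮, (v.dAS S = 0 ∨ v.dAS S = 1) ∧ (v.dSA S = 0 ∨ v.dSA S = 1)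

/-- The objective values of the feasible points of the mixed integer linear program. -/
def milpValues {n : ℕ} (𝒮 : Finset (Finset (Fin n))) (p : Finset (Fin n) → Fin n → ℝ)
    (A : Finset (Fin n)) (r : Fin n → ℝ) (ε : ℝ) : Set ℝ :=
  (fun v : MILPVars n => revenue r A v.x) '' {v | MILPFeasible 𝒮 p A ε v}

end

noncomputable section

open Filter Topology Set
open scoped NNReal

/-!
For every threshold `l`, the pointwise bound `max_{j ∈ S} u_j ≤ l + ∑_{j ∈ S} (u_j - l)⁺` bounds the
expected maximal utility by a function of the marginals alone. When the survival probabilities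
`ℙ(u_j > l)`, `j ∈ S`, sum to one, a law under which exactly one utility exceeds `l` attains the
bound, so under every optimal law the choice probabilities are these survival probabilities.

Hence a choice collection is representable exactly when the assortments have thresholds ordered
oppositely to the probabilities of each common product, with equal thresholds at equal nonzero
probabilities: the marginals are then recovered by interpolating their distribution functions. The
program imposes this on `𝒮`, but only the weak inequalities on `A`. A feasible `x` is still a limit
of consistent choices: moving it with weight `η → 0` towards the survival probabilities of marginals
that fit `𝒮` breaks the offending ties. Since the feasible values arising from the unit box form a
compact set, the closure of the revenues of the consistent choices is the set of program values.
-/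

section Survival

/-- The probability that a random utility with deterministic part `ν` and random part of law `μ`
exceeds the threshold `t`. -/
def survival (ν : ℝ) (μ : Measure ℝ) (t : ℝ) : ℝ := μ.real {e | t < ν + e}

lemma measurableSet_exceed (ν t : ℝ) : MeasurableSet {e : ℝ | t < ν + e} :=
  measurableSet_lt measurable_const (by fun_prop)

variable (ν : ℝ) (μ : Measure ℝ)

lemma survival_nonneg (t : ℝ) : 0 ≤ survival ν μ t := measureReal_nonneg

variable [IsProbabilityMeasure μ]

lemma survival_le_one (t : ℝ) : survival ν μ t ≤ 1 := measureReal_le_one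

lemma survival_eq_one_sub_cdf (t : ℝ) : survival ν μ t = 1 - cdf μ (t - ν) := by
  have h : {e : ℝ | t < ν + e} = (Iic (t - ν))ᶜ := by
    ext e; simp [sub_lt_iff_lt_add']
  rw [survival, h, probReal_compl_eq_one_sub measurableSet_Iic, cdf_eq_real]

lemma antitone_survival : Antitone (survival ν μ) := fun _ _ h =>
  measureReal_mono fun _ he => h.trans_lt he

lemma tendsto_survival_atBot : Tendsto (survival ν μ) atBot (𝓝 1) := by
  simp_rw [funext (survival_eq_one_sub_cdf ν μ)]
  simpa [sub_eq_add_neg] using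
    ((tendsto_cdf_atBot μ).comp (tendsto_atBot_add_const_right _ (-ν) tendsto_id)).const_sub 1

lemma tendsto_survival_atTop : Tendsto (survival ν μ) atTop (𝓝 0) := by
  simp_rw [funext (survival_eq_one_sub_cdf ν μ)]
  simpa [sub_eq_add_neg] using
    ((tendsto_cdf_atTop μ).comp (tendsto_atTop_add_const_right _ (-ν) tendsto_id)).const_sub 1

lemma continuous_cdf [NullSingletonClass μ] : Continuous (cdf μ) := by
  refine continuous_iff_continuousAt.2 fun a => ?_
  rw [(monotone_cdf μ).continuousAt_iff_leftLim_eq_rightLim, StieltjesFunction.rightLim_eq]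
  have no_jump := (cdf μ).measure_singleton a
  rw [measure_cdf, measure_singleton, eq_comm, ENNReal.ofReal_eq_zero, sub_nonpos] at no_jump
  exact ((monotone_cdf μ).leftLim_le le_rfl).antisymm no_jump

lemma continuous_survival [NullSingletonClass μ] : Continuous (survival ν μ) := by
  simp_rw [funext (survival_eq_one_sub_cdf ν μ)]
  exact continuous_const.sub ((continuous_cdf μ).comp (continuous_sub_right ν))

end Survival

section Flat

variable {μ : Measure ℝ} [IsProbabilityMeasure μ] {a b : ℝ}

lemma cdf_eq_of_measure_Ioc_eq_zero (hab : a ≤ b) (h : μ (Ioc a b) = 0) : cdf μ a = cdf μ b := by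
  rw [← measure_cdf μ, StieltjesFunction.measure_Ioc, ENNReal.ofReal_eq_zero, sub_nonpos] at h
  exact (monotone_cdf μ hab).antisymm h

lemma exists_mem_support_le_cdf_eq (ha : 0 < cdf μ a) :
    ∃ x ∈ μ.support, x ≤ a ∧ cdf μ x = cdf μ a := by
  have hpos : 0 < μ (Iic a) := by rwa [← ofReal_cdf, ENNReal.ofReal_pos]
  have hbdd : BddAbove (Iic a ∩ μ.support) := bddAbove_Iic.mono inter_subset_left
  obtain ⟨hle, hmem⟩ := (isClosed_Iic.inter Measure.isClosed_support).csSup_mem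
    (Measure.nonempty_inter_support_of_pos hpos) hbdd
  refine ⟨_, hmem, hle, cdf_eq_of_measure_Ioc_eq_zero hle ?_⟩
  exact measure_mono_null (fun x hx hxs => hx.1.not_ge (le_csSup hbdd ⟨hx.2, hxs⟩))
    Measure.measure_compl_support

lemma exists_mem_support_ge_cdf_eq [NullSingletonClass μ] (hb : cdf μ b < 1) :
    ∃ x ∈ μ.support, b ≤ x ∧ cdf μ x = cdf μ b := by
  have hpos : 0 < μ (Ici b) := by
    refine pos_iff_ne_zero.2 fun h0 => hb.ne ?_
    have hIic : μ (Iic b) = 1 := (prob_compl_eq_zero_iff measurableSet_Iic).1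
      (measure_mono_null (compl_Iic.trans_subset Ioi_subset_Ici_self) h0)
    rw [cdf_eq_real, measureReal_def, hIic, ENNReal.toReal_one]
  have hbdd : BddBelow (Ici b ∩ μ.support) := bddBelow_Ici.mono inter_subset_left
  obtain ⟨hle, hmem⟩ := (isClosed_Ici.inter Measure.isClosed_support).csInf_mem
    (Measure.nonempty_inter_support_of_pos hpos) hbdd
  refine ⟨_, hmem, hle, (cdf_eq_of_measure_Ioc_eq_zero hle ?_).symm⟩
  refine measure_mono_null (t := μ.supportᶜ ∪ {sInf (Ici b ∩ μ.support)}) (fun x hx => ?_)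
    (measure_union_null Measure.measure_compl_support (measure_singleton _))
  exact or_iff_not_imp_left.2 fun hxs =>
    hx.2.antisymm (csInf_le hbdd ⟨hx.1.le, notMem_compl_iff.1 hxs⟩)

end Flat

namespace IsMDMMarginal

variable {μ : Measure ℝ} {a b : ℝ}

lemma nullSingletonClass (h : IsMDMMarginal μ) : NullSingletonClass μ :=
  ⟨fun _ => h.absCont Real.volume_singleton⟩

lemma cdf_eq_zero_or_one_of_cdf_eq (h : IsMDMMarginal μ) (hab : a < b)
    (heq : cdf μ a = cdf μ b) : cdf μ b = 0 ∨ cdf μ b = 1 := by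
  have := h.prob
  have := h.nullSingletonClass
  by_contra! hne
  obtain ⟨x, hx, hxa, hcx⟩ :=
    exists_mem_support_le_cdf_eq (heq ▸ (cdf_nonneg μ b).lt_of_ne' hne.1 : 0 < cdf μ a)
  obtain ⟨y, hy, hby, hcy⟩ := exists_mem_support_ge_cdf_eq ((cdf_le_one μ b).lt_of_ne hne.2)
  exact (h.strictMono hx hy ((hxa.trans_lt hab).trans_le hby)).ne (by rw [hcx, hcy, heq])

lemma survival_eq_zero_or_one_of_survival_eq (h : IsMDMMarginal μ) (ν : ℝ) (hab : a < b)
    (heq : survival ν μ a = survival ν μ b) : survival ν μ b = 0 ∨ survival ν μ b = 1 := by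
  have := h.prob
  simp only [survival_eq_one_sub_cdf, sub_right_inj, sub_eq_zero, sub_eq_self] at heq ⊢
  exact (h.cdf_eq_zero_or_one_of_cdf_eq (sub_lt_sub_right hab ν) heq).symm.imp_left Eq.symm

end IsMDMMarginal

section Threshold

variable {ι : Type*} {S : Finset ι} {u : ι → ℝ} {l : ℝ} {i : ι}

lemma sup'_le_add_sum_posPart (hS : S.Nonempty) (u : ι → ℝ) (l : ℝ) :
    S.sup' hS u ≤ l + ∑ j ∈ S, max (u j - l) 0 := by
  refine Finset.sup'_le hS _ fun i hi => ?_
  have term_le : max (u i - l) 0 ≤ ∑ j ∈ S, max (u j - l) 0 :=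
    Finset.single_le_sum (f := fun j => max (u j - l) 0) (fun _ _ => le_max_right _ _) hi
  linarith [le_max_left (u i - l) 0]

lemma sup'_eq_of_unique_exceed (hS : S.Nonempty) (hi : i ∈ S) (hil : l < u i)
    (hne : ∀ j ∈ S, j ≠ i → u j ≤ l) : S.sup' hS u = l + ∑ j ∈ S, max (u j - l) 0 := by
  refine le_antisymm (sup'_le_add_sum_posPart hS u l) ?_
  rw [Finset.sum_eq_single_of_mem i hi fun j hj hji => max_eq_right (sub_nonpos.2 (hne j hj hji)),
    max_eq_left (sub_nonneg.2 hil.le), add_sub_cancel]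
  exact Finset.le_sup' u hi

lemma eq_of_exceed_of_sup'_eq (hS : S.Nonempty) {k : ι}
    (heq : S.sup' hS u = l + ∑ j ∈ S, max (u j - l) 0) (hi : i ∈ S) (hil : l < u i)
    (hk : k ∈ S) (hku : S.sup' hS u = u k) : k = i := by
  classical
  by_contra hki
  have pair_le : max (u k - l) 0 + max (u i - l) 0 ≤ ∑ j ∈ S, max (u j - l) 0 := by
    rw [← Finset.sum_pair (f := fun j => max (u j - l) 0) hki]
    exact Finset.sum_le_sum_of_subset_of_nonneg
      (Finset.insert_subset hk (Finset.singleton_subset_iff.2 hi)) fun _ _ _ => le_max_right _ _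
  linarith [le_max_left (u k - l) 0, le_max_left (u i - l) 0]

lemma isMax_iff_exceed (hS : S.Nonempty) (heq : S.sup' hS u = l + ∑ j ∈ S, max (u j - l) 0)
    (hi : i ∈ S) (hne : u i ≠ l) : (∀ j ∈ S, u j ≤ u i) ↔ l < u i := by
  refine ⟨fun h => hne.symm.lt_of_le ?_, fun h j hj => ?_⟩
  · have sum_nonneg : 0 ≤ ∑ j ∈ S, max (u j - l) 0 :=
      Finset.sum_nonneg fun _ _ => le_max_right _ _
    linarith [Finset.sup'_le hS u h]
  · obtain ⟨k, hk, hku⟩ := Finset.exists_mem_eq_sup' hS u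
    rw [← eq_of_exceed_of_sup'_eq hS heq hi h hk hku, ← hku]
    exact Finset.le_sup' u hj

end Threshold

section ExclusiveCoupling

variable {ι : Type*} [DecidableEq ι] {Ω : ι → Type*} [∀ i, MeasurableSpace (Ω i)]

/-- The law of coordinate `j` given that `i` is the only index of `S` whose event occurs. -/
def exclusiveFactor (μ : ∀ i, Measure (Ω i)) (E : ∀ i, Set (Ω i)) (S : Finset ι) (i j : ι) :
    Measure (Ω j) :=
  if j = i then (μ j)[|E j] else if j ∈ S then (μ j)[|(E j)ᶜ] else μ j

/-- For `∑ i ∈ S, μ i (E i) = 1`, a coupling of the laws `μ i` under which exactly one of the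
events `E i`, `i ∈ S`, occurs: first draw its index `i` with probability `μ i (E i)`, then draw the
coordinates independently given that index. -/
def exclusiveCoupling [Fintype ι] (μ : ∀ i, Measure (Ω i)) (E : ∀ i, Set (Ω i)) (S : Finset ι) :
    Measure (∀ i, Ω i) :=
  ∑ i ∈ S, μ i (E i) • Measure.pi (exclusiveFactor μ E S i)

variable {μ : ∀ i, Measure (Ω i)} [∀ i, IsProbabilityMeasure (μ i)] {E : ∀ i, Set (Ω i)}
  {S : Finset ι} {i : ι}

lemma isProbabilityMeasure_exclusiveFactor (hE : ∀ i, MeasurableSet (E i))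
    (hsum : ∑ i ∈ S, μ i (E i) = 1) (hi : i ∈ S) (hpos : μ i (E i) ≠ 0) (j : ι) :
    IsProbabilityMeasure (exclusiveFactor μ E S i j) := by
  unfold exclusiveFactor
  split_ifs with hji hj
  · subst hji; exact cond_isProbabilityMeasure hpos
  · refine cond_isProbabilityMeasure fun hnull => hpos ?_
    have hone : μ j (E j) = 1 := (prob_compl_eq_zero_iff (hE j)).1 hnull
    rw [← Finset.sum_erase_add _ _ hj, hone] at hsum
    have others : ∑ k ∈ S.erase j, μ k (E k) = 0 :=
      (ENNReal.add_left_inj ENNReal.one_ne_top).1 (hsum.trans (zero_add 1).symm)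
    exact Finset.sum_eq_zero_iff.1 others i (Finset.mem_erase.2 ⟨Ne.symm hji, hi⟩)
  · infer_instance

lemma sum_smul_exclusiveFactor (hE : ∀ i, MeasurableSet (E i))
    (hsum : ∑ i ∈ S, μ i (E i) = 1) (k : ι) :
    ∑ i ∈ S, μ i (E i) • exclusiveFactor μ E S i k = μ k := by
  by_cases hk : k ∈ S
  · have hne : ∀ i ∈ S.erase k, μ i (E i) • exclusiveFactor μ E S i k
        = μ i (E i) • (μ k)[|(E k)ᶜ] := fun i hi => by
      rw [exclusiveFactor, if_neg (Finset.ne_of_mem_erase hi).symm, if_pos hk]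
    have hcompl : ∑ i ∈ S.erase k, μ i (E i) = μ k (E k)ᶜ := by
      rw [prob_compl_eq_one_sub (hE k), ← hsum, ← Finset.add_sum_erase _ _ hk,
        ENNReal.add_sub_cancel_left (measure_ne_top _ _)]
    rw [← Finset.add_sum_erase _ _ hk, Finset.sum_congr rfl hne, ← Finset.sum_smul, hcompl,
      exclusiveFactor, if_pos rfl]
    ext t
    simp only [Measure.add_apply, Measure.smul_apply, smul_eq_mul]
    rw [mul_comm, mul_comm (μ k (E k)ᶜ), cond_add_cond_compl_eq (hE k)]
  · have hfree : ∀ i ∈ S, μ i (E i) • exclusiveFactor μ E S i k = μ i (E i) • μ k :=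
      fun i hi => by rw [exclusiveFactor, if_neg (ne_of_mem_of_not_mem hi hk).symm, if_neg hk]
    rw [Finset.sum_congr rfl hfree, ← Finset.sum_smul, hsum, one_smul]

variable [Fintype ι]

lemma map_eval_exclusiveCoupling (hE : ∀ i, MeasurableSet (E i))
    (hsum : ∑ i ∈ S, μ i (E i) = 1) (k : ι) :
    (exclusiveCoupling μ E S).map (fun ω => ω k) = μ k := by
  have map_term : ∀ i ∈ S, (μ i (E i) • Measure.pi (exclusiveFactor μ E S i)).map (fun ω => ω k)
      = μ i (E i) • exclusiveFactor μ E S i k := fun i hi => by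
    rw [Measure.map_smul]
    by_cases hpos : μ i (E i) = 0
    · rw [hpos, zero_smul, zero_smul]
    · have := isProbabilityMeasure_exclusiveFactor hE hsum hi hpos
      rw [(measurePreserving_eval (exclusiveFactor μ E S i) k).map_eq]
  rw [exclusiveCoupling, Measure.map_finset_sum (measurable_pi_apply k).aemeasurable,
    Finset.sum_congr rfl map_term, sum_smul_exclusiveFactor hE hsum]

lemma ae_exclusiveCoupling (hE : ∀ i, MeasurableSet (E i)) (hsum : ∑ i ∈ S, μ i (E i) = 1) :
    ∀ᵐ ω ∂exclusiveCoupling μ E S, ∃ i ∈ S, ω i ∈ E i ∧ ∀ j ∈ S, j ≠ i → ω j ∉ E j := by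
  rw [exclusiveCoupling, ae_finsetSum_measure_iff]
  intro i hi
  by_cases hpos : μ i (E i) = 0
  · simp [hpos]
  have := isProbabilityMeasure_exclusiveFactor hE hsum hi hpos
  have coordinate : ∀ j, ∀ᵐ ω ∂Measure.pi (exclusiveFactor μ E S i),
      (j = i → ω j ∈ E j) ∧ (j ∈ S → j ≠ i → ω j ∉ E j) := fun j => by
    refine (measurePreserving_eval (exclusiveFactor μ E S i) j).quasiMeasurePreserving.ae
      (p := fun x => (j = i → x ∈ E j) ∧ (j ∈ S → j ≠ i → x ∉ E j)) ?_
    unfold exclusiveFactor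
    split_ifs with hji hj
    · filter_upwards [ae_cond_mem (hE j)] with x hx using ⟨fun _ => hx, fun _ h => absurd hji h⟩
    · filter_upwards [ae_cond_mem (hE j).compl] with x hx using
        ⟨fun h => absurd h hji, fun _ _ => hx⟩
    · exact ae_of_all _ fun _ => ⟨fun h => absurd h hji, fun h => absurd h hj⟩
  refine Measure.ae_smul_measure ?_ _
  filter_upwards [ae_all_iff.2 coordinate] with ω hω
  exact ⟨i, hi, (hω i).1 rfl, fun j => (hω j).2⟩

end ExclusiveCoupling

section Choice

variable {n : ℕ} {ν : Fin n → ℝ} {μ : Fin n → Measure ℝ} {S : Finset (Fin n)} {l : ℝ}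
  {θ : Measure (Fin n → ℝ)}

section Integrability

variable (hint : ∀ i, Integrable (fun t => t) (μ i)) (hθ : θ ∈ jointLaws μ)
include hint hθ

lemma integrable_utility (i : Fin n) : Integrable (fun e => ν i + e i) θ := by
  have := hθ.1
  have heval : Integrable (fun t => t) (θ.map fun e => e i) := (hθ.2 i).symm ▸ hint i
  exact (integrable_const _).add (heval.comp_measurable (measurable_pi_apply i))

lemma integrable_sup'_utility (hS : S.Nonempty) :
    Integrable (fun e => S.sup' hS fun i => ν i + e i) θ := by
  have h : Integrable (S.sup' hS fun i (e : Fin n → ℝ) => ν i + e i) θ :=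
    Finset.sup'_induction hS _ (p := fun f => Integrable f θ) (fun f hf g hg => hf.sup hg)
      fun i _ => integrable_utility hint hθ i
  exact h.congr (ae_of_all _ fun e => Finset.sup'_apply hS _ e)

lemma integrable_excess (i : Fin n) : Integrable (fun e => max (ν i + e i - l) 0) θ :=
  have := hθ.1
  ((integrable_utility hint hθ i).sub (integrable_const l)).pos_part

lemma integrable_add_sum_excess :
    Integrable (fun e => l + ∑ j ∈ S, max (ν j + e j - l) 0) θ :=
  have := hθ.1
  (integrable_const _).add (integrable_finsetSum _ fun i _ => integrable_excess hint hθ i)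

lemma integral_add_sum_excess :
    ∫ e, (l + ∑ j ∈ S, max (ν j + e j - l) 0) ∂θ
      = l + ∑ j ∈ S, ∫ t, max (ν j + t - l) 0 ∂(μ j) := by
  have := hθ.1
  rw [integral_add (integrable_const _)
    (integrable_finsetSum _ fun i _ => integrable_excess hint hθ i), integral_const,
    integral_finsetSum _ fun i _ => integrable_excess hint hθ i, probReal_univ, one_smul]
  congr 1
  refine Finset.sum_congr rfl fun j _ => ?_
  rw [← hθ.2 j, integral_map (measurable_pi_apply j).aemeasurable]
  exact (by fun_prop : Continuous fun t : ℝ => max (ν j + t - l) 0).aestronglyMeasurable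

lemma expectedMaxUtility_le (hS : S.Nonempty) (l : ℝ) :
    expectedMaxUtility ν S hS θ ≤ l + ∑ j ∈ S, ∫ t, max (ν j + t - l) 0 ∂(μ j) := by
  rw [← integral_add_sum_excess hint hθ]
  exact integral_mono (integrable_sup'_utility hint hθ hS) (integrable_add_sum_excess hint hθ)
    fun e => sup'_le_add_sum_posPart hS _ l

end Integrability

variable [∀ i, IsProbabilityMeasure (μ i)]

lemma exists_mem_jointLaws_ae_sup'_eq (hS : S.Nonempty)
    (hl : ∑ i ∈ S, survival (ν i) (μ i) l = 1) :
    ∃ θ ∈ jointLaws μ,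
      ∀ᵐ e ∂θ, S.sup' hS (fun i => ν i + e i) = l + ∑ j ∈ S, max (ν j + e j - l) 0 := by
  have hE := fun i => measurableSet_exceed (ν i) l
  have hsum : ∑ i ∈ S, μ i {e | l < ν i + e} = 1 := by
    rw [← ENNReal.toReal_eq_one_iff, ENNReal.toReal_sum fun i _ => measure_ne_top _ _]
    exact hl
  have hmap := map_eval_exclusiveCoupling hE hsum
  refine ⟨exclusiveCoupling μ _ S, ⟨?_, hmap⟩, ?_⟩
  · obtain ⟨i, -⟩ := hS
    have : IsProbabilityMeasure ((exclusiveCoupling μ (fun i => {e | l < ν i + e}) S).map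
        fun e => e i) := by rw [hmap i]; infer_instance
    exact Measure.isProbabilityMeasure_of_map fun e => e i
  · filter_upwards [ae_exclusiveCoupling hE hsum] with e he
    obtain ⟨i, hi, hil, hne⟩ := he
    exact sup'_eq_of_unique_exceed hS hi hil fun j hj hji => not_lt.1 (hne j hj hji)

variable (hint : ∀ i, Integrable (fun t => t) (μ i))
include hint

lemma exists_expectedMaxUtility_eq (hS : S.Nonempty)
    (hl : ∑ i ∈ S, survival (ν i) (μ i) l = 1) :
    ∃ θ ∈ jointLaws μ,
      expectedMaxUtility ν S hS θ = l + ∑ j ∈ S, ∫ t, max (ν j + t - l) 0 ∂(μ j) := by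
  obtain ⟨θ, hθ, hae⟩ := exists_mem_jointLaws_ae_sup'_eq hS hl
  exact ⟨θ, hθ, (integral_congr_ae hae).trans (integral_add_sum_excess hint hθ)⟩

lemma ae_sup'_eq_of_isMaxOn (hS : S.Nonempty) (hl : ∑ i ∈ S, survival (ν i) (μ i) l = 1)
    (hθ : θ ∈ jointLaws μ) (hmax : IsMaxOn (expectedMaxUtility ν S hS) (jointLaws μ) θ) :
    ∀ᵐ e ∂θ, S.sup' hS (fun i => ν i + e i) = l + ∑ j ∈ S, max (ν j + e j - l) 0 := by
  obtain ⟨θ₀, hθ₀, hval⟩ := exists_expectedMaxUtility_eq hint hS hl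
  refine (integral_eq_iff_of_ae_le (integrable_sup'_utility hint hθ hS)
    (integrable_add_sum_excess hint hθ) (ae_of_all _ fun e => sup'_le_add_sum_posPart hS _ l)).1 ?_
  rw [integral_add_sum_excess hint hθ]
  exact (expectedMaxUtility_le hint hθ hS l).antisymm (hval ▸ hmax hθ₀)

variable [∀ i, NullSingletonClass (μ i)]

lemma measureReal_argmaxEvent (hS : S.Nonempty) (hl : ∑ i ∈ S, survival (ν i) (μ i) l = 1)
    (hθ : θ ∈ jointLaws μ) (hmax : IsMaxOn (expectedMaxUtility ν S hS) (jointLaws μ) θ)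
    {i : Fin n} (hi : i ∈ S) : θ.real (argmaxEvent ν S i) = survival (ν i) (μ i) l := by
  have no_tie : ∀ᵐ e ∂θ, ν i + e i ≠ l := by
    have h : ∀ᵐ t ∂(θ.map fun e => e i), ν i + t ≠ l := by
      rw [hθ.2 i]
      filter_upwards [Measure.ae_ne (μ i) (l - ν i)] with t ht using fun h => ht (by linarith)
    exact ae_of_ae_map (measurable_pi_apply i).aemeasurable h
  have argmax_eq : argmaxEvent ν S i =ᵐ[θ] (fun e => e i) ⁻¹' {t | l < ν i + t} := by
    filter_upwards [ae_sup'_eq_of_isMaxOn hint hS hl hθ hmax, no_tie] with e hsup hne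
    exact propext (isMax_iff_exceed (u := fun i => ν i + e i) hS hsup hi hne)
  rw [survival, ← hθ.2 i, measureReal_congr argmax_eq,
    map_measureReal_apply (measurable_pi_apply i) (measurableSet_exceed (ν i) l)]

lemma isMDMChoice_of_eq_survival (hS : S.Nonempty) (hl : ∑ i ∈ S, survival (ν i) (μ i) l = 1)
    {x : Fin n → ℝ} (hx : ∀ i ∈ S, x i = survival (ν i) (μ i) l) : IsMDMChoice ν μ S x := by
  obtain ⟨θ, hθ, hval⟩ := exists_expectedMaxUtility_eq hint hS hl
  have hmax : IsMaxOn (expectedMaxUtility ν S hS) (jointLaws μ) θ := fun θ' hθ' =>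
    (expectedMaxUtility_le hint hθ' hS l).trans_eq hval.symm
  exact ⟨hS, θ, hθ, hmax, fun i hi => by
    rw [hx i hi, measureReal_argmaxEvent hint hS hl hθ hmax hi]⟩

end Choice

section ExtendedThreshold

/-- The survival probability at a threshold that may be `-∞`. The value `-∞` is needed for
assortments with a single product, which is chosen with probability one. -/
def survivalBot (ν : ℝ) (μ : Measure ℝ) : WithBot ℝ → ℝ :=
  WithBot.recBotCoe 1 (survival ν μ)

@[simp] lemma survivalBot_bot (ν : ℝ) (μ : Measure ℝ) : survivalBot ν μ ⊥ = 1 := rfl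

@[simp] lemma survivalBot_coe (ν : ℝ) (μ : Measure ℝ) (t : ℝ) :
    survivalBot ν μ t = survival ν μ t := rfl

lemma survivalBot_nonneg (ν : ℝ) (μ : Measure ℝ) (l : WithBot ℝ) : 0 ≤ survivalBot ν μ l := by
  induction l using WithBot.recBotCoe with
  | bot => exact zero_le_one
  | coe t => exact survival_nonneg ν μ t

lemma antitone_survivalBot (ν : ℝ) (μ : Measure ℝ) [IsProbabilityMeasure μ] :
    Antitone (survivalBot ν μ) := fun a b hab => by
  induction a using WithBot.recBotCoe with
  | bot =>
    induction b using WithBot.recBotCoe with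
    | bot => exact le_rfl
    | coe b => exact survival_le_one ν μ b
  | coe a =>
    lift b to ℝ using ((WithBot.bot_lt_coe a).trans_le hab).ne'
    exact antitone_survival ν μ (WithBot.coe_le_coe.1 hab)

lemma IsMDMMarginal.survivalBot_eq_zero_or_one_of_eq {μ : Measure ℝ} (h : IsMDMMarginal μ) (ν : ℝ)
    {a b : WithBot ℝ} (hab : a < b) (heq : survivalBot ν μ a = survivalBot ν μ b) :
    survivalBot ν μ b = 0 ∨ survivalBot ν μ b = 1 := by
  induction a using WithBot.recBotCoe with
  | bot => exact Or.inr heq.symm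
  | coe a =>
    lift b to ℝ using ((WithBot.bot_lt_coe a).trans hab).ne'
    exact h.survival_eq_zero_or_one_of_survival_eq ν (WithBot.coe_lt_coe.1 hab) heq

lemma exists_isGreatest_le_and_eq {G : ℝ → ℝ} (hcont : Continuous G) (hanti : Antitone G) {y : ℝ}
    (hle : ∃ t, y ≤ G t) (hlt : ∃ t, G t < y) : ∃ l, IsGreatest {t | y ≤ G t} l ∧ G l = y := by
  obtain ⟨b, hb⟩ := hlt
  have hbdd : BddAbove {t | y ≤ G t} :=
    ⟨b, fun t ht => le_of_not_gt fun hbt => hb.not_ge (le_trans ht (hanti hbt.le))⟩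
  have hmem : y ≤ G (sSup {t | y ≤ G t}) :=
    (isClosed_le continuous_const hcont).csSup_mem hle hbdd
  obtain ⟨t, ht⟩ := mem_range_of_exists_le_of_exists_ge hcont ⟨b, hb.le⟩ hle
  have heq : G (sSup {t | y ≤ G t}) = y :=
    ((hanti (le_csSup hbdd ht.ge)).trans_eq ht).antisymm hmem
  exact ⟨_, ⟨hmem, fun _ h => le_csSup hbdd h⟩, heq⟩

variable {ι : Type*} {ν : ι → ℝ} {μ : ι → Measure ℝ} {S : Finset ι}

lemma le_of_survivalBot_eq (hμ : ∀ i, IsMDMMarginal (μ i)) {l a : WithBot ℝ}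
    (hl : IsGreatest {l | 1 ≤ ∑ i ∈ S, survivalBot (ν i) (μ i) l} l) {i : ι} (hi : i ∈ S)
    (heq : survivalBot (ν i) (μ i) l = survivalBot (ν i) (μ i) a)
    (hne : survivalBot (ν i) (μ i) a ≠ 0) : a ≤ l := by
  by_contra! hla
  have hone := ((hμ i).survivalBot_eq_zero_or_one_of_eq (ν i) hla heq).resolve_left hne
  have hmem : 1 ≤ ∑ j ∈ S, survivalBot (ν j) (μ j) a := hone.symm.trans_le <|
    Finset.single_le_sum (f := fun j => survivalBot (ν j) (μ j) a)
      (fun j _ => survivalBot_nonneg (ν j) (μ j) a) hi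
  exact hla.not_ge (hl.2 hmem)

variable [∀ i, IsProbabilityMeasure (μ i)]

lemma antitone_sum_survival : Antitone fun t => ∑ i ∈ S, survival (ν i) (μ i) t :=
  fun _ _ h => Finset.sum_le_sum fun i _ => antitone_survival (ν i) (μ i) h

lemma exists_sum_survival_lt {y : ℝ} (hy : 0 < y) : ∃ t, ∑ i ∈ S, survival (ν i) (μ i) t < y := by
  have htop : Tendsto (fun t => ∑ i ∈ S, survival (ν i) (μ i) t) atTop (𝓝 0) := by
    simpa using tendsto_finsetSum S fun i _ => tendsto_survival_atTop (ν i) (μ i)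
  exact (htop.eventually (gt_mem_nhds hy)).exists

lemma card_le_of_sum_survival_le {y : ℝ} (h : ∀ t, ∑ i ∈ S, survival (ν i) (μ i) t ≤ y) :
    S.card ≤ y := by
  have hbot : Tendsto (fun t => ∑ i ∈ S, survival (ν i) (μ i) t) atBot (𝓝 S.card) := by
    simpa using tendsto_finsetSum S fun i _ => tendsto_survival_atBot (ν i) (μ i)
  exact le_of_tendsto' hbot h

variable [∀ i, NullSingletonClass (μ i)]

lemma continuous_sum_survival : Continuous fun t => ∑ i ∈ S, survival (ν i) (μ i) t :=
  continuous_finsetSum _ fun i _ => continuous_survival (ν i) (μ i)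

lemma exists_isGreatest_sum_survivalBot (hS : S.Nonempty) :
    ∃ l, IsGreatest {l | 1 ≤ ∑ i ∈ S, survivalBot (ν i) (μ i) l} l ∧
      ∑ i ∈ S, survivalBot (ν i) (μ i) l = 1 := by
  by_cases hle : ∃ t, 1 ≤ ∑ i ∈ S, survival (ν i) (μ i) t
  · obtain ⟨l, hl, hsum⟩ := exists_isGreatest_le_and_eq continuous_sum_survival
      antitone_sum_survival hle (exists_sum_survival_lt zero_lt_one)
    refine ⟨l, ⟨hsum.ge, fun a ha => ?_⟩, hsum⟩
    induction a using WithBot.recBotCoe with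
    | bot => exact bot_le
    | coe t => exact WithBot.coe_le_coe.2 (hl.2 ha)
  · push Not at hle
    have hcard : S.card = 1 := le_antisymm
      (by exact_mod_cast card_le_of_sum_survival_le fun t => (hle t).le) hS.card_pos
    have hsum : ∑ i ∈ S, survivalBot (ν i) (μ i) ⊥ = 1 := by simp [hcard]
    refine ⟨⊥, ⟨hsum.ge, fun a ha => ?_⟩, hsum⟩
    induction a using WithBot.recBotCoe with
    | bot => exact le_rfl
    | coe t => exact absurd ha (hle t).not_ge

end ExtendedThreshold

section Necessity

/-- `x` restricts to a probability vector on `S`. -/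
structure IsProbVector {ι : Type*} (S : Finset ι) (x : ι → ℝ) : Prop where
  nonneg : ∀ i ∈ S, 0 ≤ x i
  sum_eq_one : ∑ i ∈ S, x i = 1

lemma IsProbVector.le_one {ι : Type*} {S : Finset ι} {x : ι → ℝ} (hx : IsProbVector S x) :
    ∀ i ∈ S, x i ≤ 1 := fun _ hi => hx.sum_eq_one ▸ Finset.single_le_sum hx.nonneg hi

/-- The levels `f` order the sets in `𝒯` oppositely to the entries `p S i` of each common element
`i`, and sets with a common entry in `U` share their level. For choice probabilities the levels
are the thresholds; `U = {0}ᶜ` holds for them, `U = Ioo 0 1` is what the reconstruction of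
marginals requires, and `U = ∅` is the closed relaxation. -/
structure OrderCompatible {ι α : Type*} [LE α] (U : Set ℝ) (𝒯 : Finset (Finset ι))
    (p : Finset ι → ι → ℝ) (f : Finset ι → α) : Prop where
  antitone : ∀ S ∈ 𝒯, ∀ T ∈ 𝒯, ∀ i ∈ S, i ∈ T → f S ≤ f T → p T i ≤ p S i
  eq_of_tie : ∀ S ∈ 𝒯, ∀ T ∈ 𝒯, ∀ i ∈ S, i ∈ T → p S i = p T i → p S i ∈ U → f S = f T

variable {n : ℕ} {ν : Fin n → ℝ} {μ : Fin n → Measure ℝ} {S : Finset (Fin n)}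
  {𝒯 : Finset (Finset (Fin n))} {p : Finset (Fin n) → Fin n → ℝ}

lemma IsMDMChoice.eq_survivalBot {x : Fin n → ℝ} (hx : IsMDMChoice ν μ S x)
    (hμ : ∀ i, IsMDMMarginal (μ i)) {l : WithBot ℝ}
    (hl : ∑ i ∈ S, survivalBot (ν i) (μ i) l = 1) :
    ∀ i ∈ S, x i = survivalBot (ν i) (μ i) l := fun i hi => by
  have := fun i => (hμ i).prob
  have := fun i => (hμ i).nullSingletonClass
  obtain ⟨hS, θ, hθ, hmax, hxθ⟩ := hx
  induction l using WithBot.recBotCoe with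
  | coe t =>
    rw [hxθ i hi, measureReal_argmaxEvent (fun i => (hμ i).integrable) hS hl hθ hmax hi,
      survivalBot_coe]
  | bot =>
    have hcard : S.card = 1 := by simpa using hl
    obtain ⟨j, rfl⟩ := Finset.card_eq_one.1 hcard
    have hself : argmaxEvent ν {j} i = univ := by
      ext e; simp [argmaxEvent, Finset.mem_singleton.1 hi]
    have := hθ.1
    rw [hxθ i hi, hself, probReal_univ, survivalBot_bot]

lemma mdmProbs.isProbVector (hp : p ∈ mdmProbs 𝒯) (hS : S ∈ 𝒯) : IsProbVector S (p S) := by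
  obtain ⟨ν, μ, hμ, hc⟩ := hp
  have := fun i => (hμ i).prob
  have := fun i => (hμ i).nullSingletonClass
  obtain ⟨l, -, hl⟩ := exists_isGreatest_sum_survivalBot (ν := ν) (μ := μ) (hc S hS).1
  have heq := (hc S hS).eq_survivalBot hμ hl
  exact ⟨fun i hi => heq i hi ▸ survivalBot_nonneg _ _ _, (Finset.sum_congr rfl heq).trans hl⟩

lemma mdmProbs.exists_orderCompatible (hp : p ∈ mdmProbs 𝒯) :
    ∃ f : Finset (Fin n) → WithBot ℝ, OrderCompatible {0}ᶜ 𝒯 p f := by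
  obtain ⟨ν, μ, hμ, hc⟩ := hp
  have := fun i => (hμ i).prob
  have := fun i => (hμ i).nullSingletonClass
  choose! f hf hsum using fun S (hS : S ∈ 𝒯) =>
    exists_isGreatest_sum_survivalBot (ν := ν) (μ := μ) (hc S hS).1
  have heq := fun S hS => (hc S hS).eq_survivalBot hμ (hsum S hS)
  refine ⟨f, fun S hS T hT i hiS hiT hle => ?_, fun S hS T hT i hiS hiT htie hne => ?_⟩
  · rw [heq S hS i hiS, heq T hT i hiT]
    exact antitone_survivalBot (ν i) (μ i) hle
  · rw [mem_compl_singleton_iff] at hne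
    have hne' := htie ▸ hne
    rw [heq S hS i hiS] at htie hne
    rw [heq T hT i hiT] at htie hne'
    exact (le_of_survivalBot_eq hμ (hf T hT) hiT htie.symm hne).antisymm
      (le_of_survivalBot_eq hμ (hf S hS) hiS htie hne')

end Necessity

section Levels

lemma exists_unitInterval_levels {ι α : Type*} [LinearOrder α] (s : Finset ι) (f : ι → α)
    {ε : ℝ} (hε : 0 ≤ ε) {N : ℕ} (hN : s.card ≤ N + 1) (hεN : ε * N ≤ 1) :
    ∃ h : ι → ℝ, (∀ a, h a ∈ Icc 0 1) ∧
      (∀ a ∈ s, ∀ b ∈ s, f a < f b → h a + ε ≤ h b) ∧ ∀ a b, f a = f b → h a = h b := by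
  let rank : ι → ℕ := fun a => (s.filter fun c => f c < f a).card
  have rank_le : ∀ a ∈ s, rank a ≤ N := fun a ha => by
    have : rank a < s.card := Finset.card_lt_card
      ⟨Finset.filter_subset _ _, fun h => by simpa using h ha⟩
    lia
  have rank_lt : ∀ a ∈ s, ∀ b, f a < f b → rank a < rank b := fun a ha b hab =>
    Finset.card_lt_card ⟨Finset.monotone_filter_right s fun _ _ hc => hc.trans hab,
      fun h => by simpa using h (Finset.mem_filter.2 ⟨ha, hab⟩)⟩
  refine ⟨fun a => min 1 (ε * rank a), fun a => ⟨by positivity, min_le_left _ _⟩,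
    fun a ha b hb hab => ?_, fun a b hab => by simp only [rank, hab]⟩
  have succ_le : (rank a : ℝ) + 1 ≤ rank b := by exact_mod_cast rank_lt a ha b hab
  have le_N : (rank b : ℝ) ≤ N := by exact_mod_cast rank_le b hb
  calc min 1 (ε * rank a) + ε ≤ ε * rank a + ε := by gcongr; exact min_le_right _ _
    _ = ε * (rank a + 1) := by ring
    _ ≤ min 1 (ε * rank b) :=
      le_min ((by gcongr; linarith : _ ≤ ε * (N : ℝ)).trans hεN) (by gcongr)

lemma OrderCompatible.exists_unitInterval_levels {ι α : Type*} [LinearOrder α] {U : Set ℝ}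
    {𝒯 : Finset (Finset ι)} {p : Finset ι → ι → ℝ} {f : Finset ι → α}
    (hf : OrderCompatible U 𝒯 p f) {ε : ℝ} (hε : 0 < ε) {N : ℕ} (hN : 𝒯.card ≤ N + 1)
    (hεN : ε * N ≤ 1) :
    ∃ h : Finset ι → ℝ, (∀ S, h S ∈ Icc 0 1) ∧
      (∀ S ∈ 𝒯, ∀ T ∈ 𝒯, h S < h T → h S + ε ≤ h T) ∧ OrderCompatible U 𝒯 p h := by
  obtain ⟨h, hmem, hgap, heq⟩ := _root_.exists_unitInterval_levels 𝒯 f hε.le hN hεN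
  have le_of_le : ∀ S ∈ 𝒯, ∀ T ∈ 𝒯, h S ≤ h T → f S ≤ f T := fun S hS T hT hle => by
    by_contra! hlt
    linarith [hgap T hT S hS hlt]
  refine ⟨h, hmem, fun S hS T hT hlt => ?_, fun S hS T hT i hiS hiT hle => ?_,
    fun S hS T hT i hiS hiT htie hU => heq S T (hf.eq_of_tie S hS T hT i hiS hiT htie hU)⟩
  · exact hgap S hS T hT ((le_of_le S hS T hT hlt.le).lt_of_ne fun h => hlt.ne (heq S T h))
  · exact hf.antitone S hS T hT i hiS hiT (le_of_le S hS T hT hle)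

end Levels

section QuantileLaw

/-- The law on `ℝ` with quantile function `H⁻¹`, that is, with distribution function `H` clamped
to `[0, 1]`. -/
def quantileLaw (H : ℝ ≃o ℝ) : Measure ℝ := (volume.restrict (Icc 0 1)).map H.symm

variable (H : ℝ ≃o ℝ)

lemma quantileLaw_apply {s : Set ℝ} (hs : MeasurableSet s) :
    quantileLaw H s = volume (H '' s ∩ Icc 0 1) := by
  have hmeas : Measurable H.symm := H.symm.continuous.measurable
  rw [quantileLaw, Measure.map_apply hmeas hs, Measure.restrict_apply (hmeas hs),
    H.image_eq_preimage_symm]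

instance isProbabilityMeasure_quantileLaw : IsProbabilityMeasure (quantileLaw H) :=
  ⟨by rw [quantileLaw_apply H .univ, image_univ_of_surjective H.surjective]; simp⟩

lemma cdf_quantileLaw (t : ℝ) : cdf (quantileLaw H) t = max 0 (min 1 (H t)) := by
  have himage : H '' Iic t ∩ Icc 0 1 = Icc 0 (min 1 (H t)) := by
    ext y; simp [H.image_Iic]; tauto
  rw [cdf_eq_real, measureReal_def, quantileLaw_apply H measurableSet_Iic, himage, Real.volume_Icc,
    sub_zero, ENNReal.toReal_ofReal', max_comm]

lemma support_quantileLaw_subset : (quantileLaw H).support ⊆ Icc (H.symm 0) (H.symm 1) := by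
  refine Measure.support_subset_of_isClosed isClosed_Icc ?_
  rw [mem_ae_iff, quantileLaw_apply H measurableSet_Icc.compl, image_compl_eq H.bijective]
  simp

lemma isMDMMarginal_quantileLaw {K : ℝ≥0} (hH : LipschitzWith K H) :
    IsMDMMarginal (quantileLaw H) where
  prob := inferInstance
  absCont := Measure.AbsolutelyContinuous.mk fun s hs hnull => by
    rw [quantileLaw_apply H hs]
    refine measure_mono_null inter_subset_left ?_
    have := hH.lipschitzOnWith.hausdorffMeasure_image_le (s := s) zero_le_one
    simpa [hnull] using this
  strictMono := by
    have hEq : EqOn H (cdf (quantileLaw H)) (quantileLaw H).support := fun x hx => by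
      obtain ⟨h0, h1⟩ := support_quantileLaw_subset H hx
      rw [cdf_quantileLaw, min_eq_right (H.le_symm_apply.1 h1),
        max_eq_right (H.symm_apply_le.1 h0)]
    exact (H.strictMono.strictMonoOn _).congr hEq
  integrable := by
    have hcont : Continuous H.symm := H.symm.continuous
    refine (integrable_map_measure aestronglyMeasurable_id hcont.aemeasurable).2 ?_
    exact hcont.integrableOn_Icc

end QuantileLaw

section Interpolation

variable {c L : ℝ}

/-- For `c ≤ L`, the function of slope `L` on the right and `c` on the left of `0`. -/
def hinge (c L s : ℝ) : ℝ := max (L * s) (c * s)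

lemma hinge_add_le (hcL : c ≤ L) {s t : ℝ} (hst : s ≤ t) :
    hinge c L s + c * (t - s) ≤ hinge c L t := by
  unfold hinge
  rw [← max_add_add_right, mul_sub]
  exact max_le (le_max_of_le_left (by nlinarith)) (le_max_of_le_right (by linarith))

lemma hinge_le_add (hcL : c ≤ L) {s t : ℝ} (hst : s ≤ t) :
    hinge c L t ≤ hinge c L s + L * (t - s) := by
  unfold hinge
  rw [← max_add_add_right, mul_sub]
  exact max_le (le_max_of_le_left (by linarith)) (le_max_of_le_right (by nlinarith))

/-- The lower envelope of the hinges whose kinks are the points of `P`. It stays below each point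
of `P`, and passes through it as soon as the slopes between the points of `P` lie between `c` and
`L`. -/
def hingeEnvelope (c L : ℝ) (P : Finset (ℝ × ℝ)) (hP : P.Nonempty) (t : ℝ) : ℝ :=
  P.inf' hP fun a => a.2 + hinge c L (t - a.1)

variable {P : Finset (ℝ × ℝ)} {hP : P.Nonempty}

lemma hingeEnvelope_add_le (hcL : c ≤ L) {s t : ℝ} (hst : s ≤ t) :
    hingeEnvelope c L P hP s + c * (t - s) ≤ hingeEnvelope c L P hP t := by
  refine Finset.le_inf' hP _ fun a ha => ?_
  have hs : hingeEnvelope c L P hP s ≤ a.2 + hinge c L (s - a.1) := Finset.inf'_le _ ha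
  have hinc := hinge_add_le hcL (sub_le_sub_right hst a.1)
  rw [sub_sub_sub_cancel_right] at hinc
  linarith

lemma hingeEnvelope_le_add (hcL : c ≤ L) {s t : ℝ} (hst : s ≤ t) :
    hingeEnvelope c L P hP t ≤ hingeEnvelope c L P hP s + L * (t - s) := by
  obtain ⟨a, ha, hs⟩ := Finset.exists_mem_eq_inf' hP fun a => a.2 + hinge c L (s - a.1)
  have ht : hingeEnvelope c L P hP t ≤ a.2 + hinge c L (t - a.1) := Finset.inf'_le _ ha
  have hinc := hinge_le_add hcL (sub_le_sub_right hst a.1)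
  rw [sub_sub_sub_cancel_right] at hinc
  have hs' : hingeEnvelope c L P hP s = a.2 + hinge c L (s - a.1) := hs
  linarith

lemma exists_marginal_of_slopes {G : ℝ → ℝ} (hc : 0 < c)
    (hlow : ∀ s t, s ≤ t → G s + c * (t - s) ≤ G t)
    (hup : ∀ s t, s ≤ t → G t ≤ G s + L * (t - s)) :
    ∃ μ, IsMDMMarginal μ ∧ (∀ t, cdf μ t = max 0 (min 1 (G t))) ∧ ∃ t, cdf μ t = 0 := by
  have hmono : StrictMono G := fun s t hst => by
    linarith [hlow s t hst.le, mul_pos hc (sub_pos.2 hst)]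
  have hL : 0 ≤ L := by linarith [hlow 0 1 zero_le_one, hup 0 1 zero_le_one]
  have hlip : LipschitzWith L.toNNReal G := LipschitzWith.of_le_add_mul' L fun s t => by
    rcases le_total s t with hst | hts
    · exact (hmono.monotone hst).trans (le_add_of_nonneg_right (by positivity))
    · rw [Real.dist_eq, abs_of_nonneg (sub_nonneg.2 hts)]
      exact hup t s hts
  have htop : Tendsto G atTop atTop := tendsto_atTop_mono' _
    ((eventually_ge_atTop 0).mono fun t ht => by simpa using hlow 0 t ht)
    (tendsto_atTop_add_const_left _ (G 0) (tendsto_id.const_mul_atTop hc))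
  have hbot : Tendsto G atBot atBot := tendsto_atBot_mono' _
    ((eventually_le_atBot 0).mono fun t ht => by simp only [id]; linarith [hlow t 0 ht])
    (tendsto_atBot_add_const_left _ (G 0) (tendsto_id.const_mul_atBot hc))
  let H : ℝ ≃o ℝ := hmono.orderIsoOfSurjective G (hlip.continuous.surjective htop hbot)
  exact ⟨quantileLaw H, isMDMMarginal_quantileLaw H hlip, cdf_quantileLaw H, H.symm 0, by
    simp [cdf_quantileLaw]⟩

variable {ι : Type*} {s : Finset ι} {τ q : ι → ℝ}

lemma exists_slope_bounds (hlt : ∀ a ∈ s, ∀ b ∈ s, q a < q b → τ a < τ b) :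
    ∃ c L, 0 < c ∧ c ≤ L ∧ ∀ a ∈ s, ∀ b ∈ s, q a < q b →
      q b - q a ∈ Icc (c * (τ b - τ a)) (L * (τ b - τ a)) := by
  have hsmall : ∀ᶠ c in 𝓝[>] (0 : ℝ), ∀ a ∈ s, ∀ b ∈ s,
      q a < q b → c * (τ b - τ a) ≤ q b - q a := by
    simp only [eventually_all_finset, eventually_imp_distrib_left]
    exact fun a _ b _ hab => nhdsWithin_le_nhds (Filter.Tendsto.eventually_le_const
      (sub_pos.2 hab) (Continuous.tendsto' (by fun_prop) _ _ (zero_mul _)))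
  have hlarge : ∀ᶠ L in (atTop : Filter ℝ), ∀ a ∈ s, ∀ b ∈ s,
      q a < q b → q b - q a ≤ L * (τ b - τ a) := by
    simp only [eventually_all_finset, eventually_imp_distrib_left]
    exact fun a ha b hb hab =>
      (tendsto_id.atTop_mul_const (sub_pos.2 (hlt a ha b hb hab))).eventually_ge_atTop _
  obtain ⟨c, hc, hc0⟩ := (hsmall.and self_mem_nhdsWithin).exists
  obtain ⟨L, hL, hcL⟩ := (hlarge.and (eventually_ge_atTop c)).exists
  exact ⟨c, L, hc0, hcL, fun a ha b hb hab => ⟨hc a ha b hb hab, hL a ha b hb hab⟩⟩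

lemma le_add_hinge
    (hslope : ∀ a ∈ s, ∀ b ∈ s, q a < q b →
      q b - q a ∈ Icc (c * (τ b - τ a)) (L * (τ b - τ a)))
    {a b : ι} (ha : a ∈ s) (hb : b ∈ s) (heq : q a = q b → τ a = τ b) :
    q b ≤ q a + hinge c L (τ b - τ a) := by
  unfold hinge
  rcases lt_trichotomy (q a) (q b) with hab | hab | hab
  · linarith [(hslope a ha b hb hab).2, le_max_left (L * (τ b - τ a)) (c * (τ b - τ a))]
  · simp [hab, heq hab]
  · linarith [(hslope b hb a ha hab).1, le_max_right (L * (τ b - τ a)) (c * (τ b - τ a))]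

lemma exists_marginal_cdf_eq (hq : ∀ a ∈ s, q a ∈ Icc 0 1)
    (hlt : ∀ a ∈ s, ∀ b ∈ s, q a < q b → τ a < τ b)
    (heq : ∀ a ∈ s, ∀ b ∈ s, q a = q b → q a ∈ Ioo 0 1 → τ a = τ b) :
    ∃ μ, IsMDMMarginal μ ∧ (∀ a ∈ s, cdf μ (τ a) = q a) ∧ ∃ t, cdf μ t = 0 := by
  classical
  obtain ⟨c, L, hc, hcL, hslope⟩ := exists_slope_bounds hlt
  obtain ⟨t₀, ht₀⟩ : BddBelow (τ '' s) := (s.finite_toSet.image τ).bddBelow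
  let P : Finset (ℝ × ℝ) := insert (t₀, 1) ((s.filter fun a => q a < 1).image fun a => (τ a, q a))
  have hP : P.Nonempty := Finset.insert_nonempty _ _
  obtain ⟨μ, hμ, hcdf, hzero⟩ := exists_marginal_of_slopes (G := hingeEnvelope c L P hP) hc
    (fun _ _ => hingeEnvelope_add_le hcL) fun _ _ => hingeEnvelope_le_add hcL
  refine ⟨μ, hμ, fun b hb => ?_, hzero⟩
  have le_of_lt_one : q b < 1 → hingeEnvelope c L P hP (τ b) ≤ q b := fun h1 => by
    have hbP : (τ b, q b) ∈ P := Finset.mem_insert_of_mem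
      (Finset.mem_image_of_mem (fun a => (τ a, q a)) (Finset.mem_filter.2 ⟨hb, h1⟩))
    exact (Finset.inf'_le _ hbP).trans_eq (by simp [hinge])
  have ge_of_pos : 0 < q b → q b ≤ hingeEnvelope c L P hP (τ b) := fun h0 => by
    refine Finset.le_inf' hP _ fun a ha => ?_
    simp only [P, Finset.mem_insert, Finset.mem_image, Finset.mem_filter] at ha
    rcases ha with rfl | ⟨a, ⟨ha, ha1⟩, rfl⟩
    · have hnonneg : 0 ≤ c * (τ b - t₀) :=
        mul_nonneg hc.le (sub_nonneg.2 (ht₀ (mem_image_of_mem τ hb)))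
      exact (hq b hb).2.trans (le_add_of_nonneg_right (le_max_of_le_right hnonneg))
    · exact le_add_hinge hslope ha hb fun hab => heq a ha b hb hab ⟨hab ▸ h0, ha1⟩
  rw [hcdf]
  rcases (hq b hb).1.eq_or_lt with h0 | h0
  · rw [← h0] at le_of_lt_one ⊢
    exact max_eq_left ((min_le_right _ _).trans (le_of_lt_one one_pos))
  rcases (hq b hb).2.eq_or_lt with h1 | h1
  · rw [min_eq_left (h1 ▸ ge_of_pos h0), h1, max_eq_right zero_le_one]
  · rw [(le_of_lt_one h1).antisymm (ge_of_pos h0), min_eq_right h1.le, max_eq_right h0.le]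

end Interpolation

section Sufficiency

lemma abs_sub_le_abs_sum_sub_of_antitone {ι α : Type*} [LinearOrder α] {S : Finset ι}
    {g : ι → α → ℝ} (hg : ∀ i ∈ S, Antitone (g i)) {i : ι} (hi : i ∈ S) (a b : α) :
    |g i a - g i b| ≤ |∑ j ∈ S, g j a - ∑ j ∈ S, g j b| := by
  wlog hab : a ≤ b generalizing a b
  · rw [abs_sub_comm, abs_sub_comm (∑ j ∈ S, g j a)]
    exact this b a (le_of_not_ge hab)
  have hnonneg : ∀ j ∈ S, 0 ≤ g j a - g j b := fun j hj => sub_nonneg.2 (hg j hj hab)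
  rw [← Finset.sum_sub_distrib, abs_of_nonneg (hnonneg i hi),
    abs_of_nonneg (Finset.sum_nonneg hnonneg)]
  exact Finset.single_le_sum hnonneg hi

lemma OrderCompatible.mono {ι α : Type*} [LE α] {U V : Set ℝ} {𝒯 : Finset (Finset ι)}
    {p : Finset ι → ι → ℝ} {f : Finset ι → α} (hf : OrderCompatible U 𝒯 p f) (hVU : V ⊆ U) :
    OrderCompatible V 𝒯 p f where
  antitone := hf.antitone
  eq_of_tie S hS T hT i hiS hiT htie hV := hf.eq_of_tie S hS T hT i hiS hiT htie (hVU hV)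

lemma OrderCompatible.exists_marginals {ι : Type*} {𝒯 : Finset (Finset ι)} {p : Finset ι → ι → ℝ}
    {f : Finset ι → ℝ} (hf : OrderCompatible (Ioo 0 1) 𝒯 p f)
    (hp : ∀ S ∈ 𝒯, ∀ i ∈ S, p S i ∈ Icc 0 1) :
    ∃ μ : ι → Measure ℝ, (∀ i, IsMDMMarginal (μ i)) ∧
      (∀ S ∈ 𝒯, ∀ i ∈ S, survival 0 (μ i) (f S) = p S i) ∧ ∀ i, ∃ t, survival 0 (μ i) t = 1 := by
  classical
  have exists_marginal : ∀ i, ∃ μ, IsMDMMarginal μ ∧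
      (∀ S ∈ 𝒯.filter (i ∈ ·), cdf μ (f S) = 1 - p S i) ∧ ∃ t, cdf μ t = 0 := fun i => by
    refine exists_marginal_cdf_eq (fun S hS => ?_) (fun S hS T hT hlt => ?_)
      fun S hS T hT htie hmem => ?_ <;> simp only [Finset.mem_filter] at hS
    · exact Icc.one_sub_mem (hp S hS.1 i hS.2)
    · obtain ⟨hT, hiT⟩ := Finset.mem_filter.1 hT
      by_contra! hle
      linarith [hf.antitone T hT S hS.1 i hiT hS.2 hle]
    · obtain ⟨hT, hiT⟩ := Finset.mem_filter.1 hT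
      exact hf.eq_of_tie S hS.1 T hT i hS.2 hiT (by linarith)
        ⟨by linarith [hmem.2], by linarith [hmem.1]⟩
  choose μ hμ hfit hzero using exists_marginal
  have := fun i => (hμ i).prob
  refine ⟨μ, hμ, fun S hS i hi => ?_, fun i => ?_⟩
  · rw [survival_eq_one_sub_cdf, sub_zero, hfit i S (Finset.mem_filter.2 ⟨hS, hi⟩), sub_sub_cancel]
  · obtain ⟨t, ht⟩ := hzero i
    exact ⟨t, by rw [survival_eq_one_sub_cdf, sub_zero, ht, sub_zero]⟩

lemma IsProbVector.nonempty {ι : Type*} {S : Finset ι} {x : ι → ℝ} (hx : IsProbVector S x) :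
    S.Nonempty := Finset.nonempty_of_sum_ne_zero (hx.sum_eq_one ▸ one_ne_zero)

lemma exists_sum_survival_eq_one {ι : Type*} {ν : ι → ℝ} {μ : ι → Measure ℝ}
    (hμ : ∀ i, IsMDMMarginal (μ i)) (hone : ∀ i, ∃ t, survival (ν i) (μ i) t = 1) {S : Finset ι}
    (hS : S.Nonempty) : ∃ l, ∑ i ∈ S, survival (ν i) (μ i) l = 1 := by
  have := fun i => (hμ i).prob
  have := fun i => (hμ i).nullSingletonClass
  obtain ⟨i, hi⟩ := hS
  obtain ⟨t, ht⟩ := hone i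
  have one_le : 1 ≤ ∑ j ∈ S, survival (ν j) (μ j) t := ht.symm.trans_le <|
    Finset.single_le_sum (f := fun j => survival (ν j) (μ j) t)
      (fun j _ => survival_nonneg (ν j) (μ j) t) hi
  obtain ⟨b, hb⟩ := exists_sum_survival_lt (S := S) (ν := ν) (μ := μ) one_pos
  exact mem_range_of_exists_le_of_exists_ge continuous_sum_survival ⟨b, hb.le⟩ ⟨t, one_le⟩

variable {n : ℕ} {𝒮 : Finset (Finset (Fin n))} {p : Finset (Fin n) → Fin n → ℝ}
  {A : Finset (Fin n)} {f : Finset (Fin n) → ℝ} {μ : Fin n → Measure ℝ}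

lemma survival_mem_consistentChoices (hp : ∀ S ∈ 𝒮, IsProbVector S (p S)) (hA : A.Nonempty)
    (hA𝒮 : A ∉ 𝒮) (hμ : ∀ i, IsMDMMarginal (μ i))
    (hfit : ∀ S ∈ 𝒮, ∀ i ∈ S, survival 0 (μ i) (f S) = p S i) {l : ℝ}
    (hl : ∑ i ∈ A, survival 0 (μ i) l = 1) :
    (fun i => survival 0 (μ i) l) ∈ consistentChoices 𝒮 p A := by
  have := fun i => (hμ i).prob
  have := fun i => (hμ i).nullSingletonClass
  refine ⟨0, μ, hμ, (Finset.forall_mem_insert _ _ _).2 ⟨?_, fun S hS => ?_⟩⟩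
  · rw [Function.update_self]
    exact isMDMChoice_of_eq_survival (fun i => (hμ i).integrable) hA hl fun _ _ => rfl
  · rw [Function.update_of_ne (ne_of_mem_of_not_mem hS hA𝒮)]
    refine isMDMChoice_of_eq_survival (l := f S) (fun i => (hμ i).integrable) (hp S hS).nonempty ?_
      fun i hi => (hfit S hS i hi).symm
    exact (Finset.sum_congr rfl (hfit S hS)).trans (hp S hS).sum_eq_one

lemma exists_consistentChoice_abs_sub_le (hp : ∀ S ∈ 𝒮, IsProbVector S (p S)) (hA : A.Nonempty)
    (hA𝒮 : A ∉ 𝒮) (hμ : ∀ i, IsMDMMarginal (μ i))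
    (hfit : ∀ S ∈ 𝒮, ∀ i ∈ S, survival 0 (μ i) (f S) = p S i)
    (hone : ∀ i, ∃ t, survival 0 (μ i) t = 1) (t : ℝ) :
    ∃ z ∈ consistentChoices 𝒮 p A, ∀ i ∈ A,
      |z i - survival 0 (μ i) t| ≤ |1 - ∑ j ∈ A, survival 0 (μ j) t| := by
  obtain ⟨l, hl⟩ := exists_sum_survival_eq_one (ν := 0) hμ hone hA
  refine ⟨_, survival_mem_consistentChoices hp hA hA𝒮 hμ hfit hl, fun i hi => ?_⟩
  have := fun i => (hμ i).prob
  have habs := abs_sub_le_abs_sum_sub_of_antitone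
    (fun j _ => antitone_survival 0 (μ j)) hi l t
  rwa [show ∑ j ∈ A, survival 0 (μ j) l = 1 from hl] at habs

end Sufficiency

section Perturbation

/-- The collection `p` moved with weight `η` towards the survival probabilities, under the
marginals `κ`, at the levels `f`. -/
def mixedProbs {ι : Type*} (κ : ι → Measure ℝ) (f : Finset ι → ℝ) (p : Finset ι → ι → ℝ) (η : ℝ) :
    Finset ι → ι → ℝ := fun S i => (1 - η) * p S i + η * survival 0 (κ i) (f S)

variable {ι : Type*} {𝒯 : Finset (Finset ι)} {p : Finset ι → ι → ℝ} {f : Finset ι → ℝ}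
  {κ : ι → Measure ℝ} {η : ℝ}

lemma mixedProbs_eq_of_survival_eq {S : Finset ι} {i : ι} (h : survival 0 (κ i) (f S) = p S i) :
    mixedProbs κ f p η S i = p S i := by rw [mixedProbs, h]; ring

lemma orderCompatible_mixedProbs (hf : OrderCompatible ∅ 𝒯 p f) (hκ : ∀ i, IsMDMMarginal (κ i))
    {A : Finset ι} (hfit : ∀ S ∈ 𝒯, S ≠ A → ∀ i ∈ S, survival 0 (κ i) (f S) = p S i)
    (hη : η ∈ Ioo 0 1) : OrderCompatible (Ioo 0 1) 𝒯 (mixedProbs κ f p η) f := by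
  have := fun i => (hκ i).prob
  have hη' : 0 < 1 - η := sub_pos.2 hη.2
  have not_lt : ∀ S ∈ 𝒯, ∀ T ∈ 𝒯, ∀ i ∈ S, i ∈ T →
      mixedProbs κ f p η S i = mixedProbs κ f p η T i →
      mixedProbs κ f p η S i ∈ Ioo 0 1 → ¬ f S < f T := by
    intro S hS T hT i hiS hiT htie hmem hlt
    have hple := hf.antitone S hS T hT i hiS hiT hlt.le
    have hsle := antitone_survival 0 (κ i) hlt.le
    simp only [mixedProbs] at htie hmem
    have hp_eq : p S i = p T i := by nlinarith [hη.1]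
    have hs_eq : survival 0 (κ i) (f S) = survival 0 (κ i) (f T) := by nlinarith [hη.1]
    have hs_eq_p : survival 0 (κ i) (f S) = p S i := by
      by_cases hSA : S = A
      · have hTA : T ≠ A := fun h => hlt.ne (by rw [hSA, h])
        rw [hs_eq, hp_eq, hfit T hT hTA i hiT]
      · exact hfit S hS hSA i hiS
    have hflat := (hκ i).survival_eq_zero_or_one_of_survival_eq 0 hlt hs_eq
    rw [← hs_eq_p, ← add_mul, sub_add_cancel, one_mul, hs_eq] at hmem
    exact hflat.elim hmem.1.ne' hmem.2.ne
  refine ⟨fun S hS T hT i hiS hiT hle => ?_, fun S hS T hT i hiS hiT htie hmem => ?_⟩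
  · exact add_le_add
      (mul_le_mul_of_nonneg_left (hf.antitone S hS T hT i hiS hiT hle) hη'.le)
      (mul_le_mul_of_nonneg_left (antitone_survival 0 (κ i) hle) hη.1.le)
  · exact le_antisymm (le_of_not_gt (not_lt T hT S hS i hiT hiS htie.symm (htie ▸ hmem)))
      (le_of_not_gt (not_lt S hS T hT i hiS hiT htie hmem))

lemma mixedProbs_mem_Icc [∀ i, IsProbabilityMeasure (κ i)] {S : Finset ι} {i : ι}
    (hp : p S i ∈ Icc 0 1) (hη : η ∈ Icc 0 1) : mixedProbs κ f p η S i ∈ Icc 0 1 :=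
  convex_Icc (0 : ℝ) 1 hp ⟨survival_nonneg 0 (κ i) (f S), survival_le_one 0 (κ i) (f S)⟩
    (sub_nonneg.2 hη.2) hη.1 (sub_add_cancel 1 η)

lemma abs_mixedProbs_sub_le [∀ i, IsProbabilityMeasure (κ i)] {S : Finset ι} {i : ι}
    (hp : p S i ∈ Icc 0 1) (hη : 0 ≤ η) : |mixedProbs κ f p η S i - p S i| ≤ η := by
  have hdist : |survival 0 (κ i) (f S) - p S i| ≤ 1 := abs_sub_le_of_nonneg_of_le
    (survival_nonneg 0 (κ i) (f S)) (survival_le_one 0 (κ i) (f S)) hp.1 hp.2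
  have heq : mixedProbs κ f p η S i - p S i = η * (survival 0 (κ i) (f S) - p S i) := by
    rw [mixedProbs]; ring
  rw [heq, abs_mul, abs_of_nonneg hη]
  exact mul_le_of_le_one_right hη hdist

variable {n : ℕ} {𝒮 : Finset (Finset (Fin n))} {p : Finset (Fin n) → Fin n → ℝ}
  {A : Finset (Fin n)} {f : Finset (Fin n) → ℝ} {x : Fin n → ℝ}

lemma exists_consistentChoice_near (hp : ∀ S ∈ 𝒮, IsProbVector S (p S)) (hA𝒮 : A ∉ 𝒮)
    (hdata : OrderCompatible {0}ᶜ 𝒮 p f) (hx : IsProbVector A x)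
    (hweak : OrderCompatible ∅ (insert A 𝒮) (Function.update p A x) f) {η : ℝ}
    (hη : η ∈ Ioo 0 1) :
    ∃ z ∈ consistentChoices 𝒮 p A, ∀ i ∈ A, |z i - x i| ≤ (A.card + 1) * η := by
  let p' := Function.update p A x
  have hp'A : p' A = x := Function.update_self A x p
  have hp'𝒮 : ∀ S ∈ 𝒮, p' S = p S := fun S hS =>
    Function.update_of_ne (ne_of_mem_of_not_mem hS hA𝒮) x p
  have hp' : ∀ S ∈ insert A 𝒮, ∀ i ∈ S, p' S i ∈ Icc 0 1 :=
    (Finset.forall_mem_insert _ _ _).2 ⟨fun i hi => hp'A ▸ ⟨hx.nonneg i hi, hx.le_one i hi⟩,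
      fun S hS i hi => hp'𝒮 S hS ▸ ⟨(hp S hS).nonneg i hi, (hp S hS).le_one i hi⟩⟩
  obtain ⟨κ, hκ, hκfit, -⟩ := (hdata.mono fun _ h => h.1.ne').exists_marginals
    fun S hS i hi => hp'𝒮 S hS ▸ hp' S (Finset.mem_insert_of_mem hS) i hi
  have := fun i => (hκ i).prob
  have hκfit' : ∀ S ∈ 𝒮, ∀ i ∈ S, survival 0 (κ i) (f S) = p' S i := fun S hS =>
    hp'𝒮 S hS ▸ hκfit S hS
  have hmix := orderCompatible_mixedProbs hweak hκ (A := A)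
    (fun S hS hSA => hκfit' S (Finset.mem_of_mem_insert_of_ne hS hSA)) hη
  obtain ⟨μ, hμ, hμfit, hone⟩ := hmix.exists_marginals fun S hS i hi =>
    mixedProbs_mem_Icc (hp' S hS i hi) (Ioo_subset_Icc_self hη)
  have hμfit𝒮 : ∀ S ∈ 𝒮, ∀ i ∈ S, survival 0 (μ i) (f S) = p S i := fun S hS i hi => by
    rw [hμfit S (Finset.mem_insert_of_mem hS) i hi, mixedProbs_eq_of_survival_eq
      (hκfit' S hS i hi), hp'𝒮 S hS]
  have hμfitA : ∀ i ∈ A, |survival 0 (μ i) (f A) - x i| ≤ η := fun i hi => by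
    have hmem := Finset.mem_insert_self A 𝒮
    rw [hμfit A hmem i hi]
    simpa only [hp'A] using abs_mixedProbs_sub_le (hp' A hmem i hi) hη.1.le
  obtain ⟨z, hz, hnear⟩ :=
    exists_consistentChoice_abs_sub_le hp hx.nonempty hA𝒮 hμ hμfit𝒮 hone (f A)
  refine ⟨z, hz, fun i hi => ?_⟩
  have hdefect : |1 - ∑ j ∈ A, survival 0 (μ j) (f A)| ≤ A.card * η := by
    rw [abs_sub_comm, ← hx.sum_eq_one, ← Finset.sum_sub_distrib, ← nsmul_eq_mul]
    exact (Finset.abs_sum_le_sum_abs _ _).trans (Finset.sum_le_card_nsmul A _ η hμfitA)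
  linarith [abs_sub_le (z i) (survival 0 (μ i) (f A)) (x i), hnear i hi, hμfitA i hi]

lemma revenue_mem_closure_consistentRevenues (hp : ∀ S ∈ 𝒮, IsProbVector S (p S)) (hA𝒮 : A ∉ 𝒮)
    (hdata : OrderCompatible {0}ᶜ 𝒮 p f) (hx : IsProbVector A x)
    (hweak : OrderCompatible ∅ (insert A 𝒮) (Function.update p A x) f) (r : Fin n → ℝ) :
    revenue r A x ∈ closure (consistentRevenues 𝒮 p A r) := by
  choose! z hz hnear using fun η (hη : η ∈ Ioo (0 : ℝ) 1) =>
    exists_consistentChoice_near hp hA𝒮 hdata hx hweak hη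
  have hη : ∀ᶠ η in 𝓝[>] (0 : ℝ), η ∈ Ioo (0 : ℝ) 1 := Ioo_mem_nhdsGT one_pos
  have hbound : Tendsto (fun η : ℝ => (A.card + 1) * η) (𝓝[>] 0) (𝓝 0) :=
    tendsto_nhdsWithin_of_tendsto_nhds (Continuous.tendsto' (by fun_prop) _ _ (mul_zero _))
  have hlim : ∀ i ∈ A, Tendsto (fun η => z η i) (𝓝[>] 0) (𝓝 (x i)) := fun i hi =>
    tendsto_iff_dist_tendsto_zero.2 <| squeeze_zero' (.of_forall fun _ => dist_nonneg)
      (hη.mono fun η h => hnear η h i hi) hbound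
  exact mem_closure_of_tendsto (tendsto_finsetSum A fun i hi => (hlim i hi).const_mul (r i))
    (hη.mono fun η h => mem_image_of_mem (revenue r A) (hz η h))

end Perturbation

section Program

variable {n : ℕ} {𝒮 : Finset (Finset (Fin n))} {p : Finset (Fin n) → Fin n → ℝ}
  {A : Finset (Fin n)} {ε : ℝ} {x : Fin n → ℝ}

lemma orderCompatible_insert_update_iff {ι α : Type*} [DecidableEq ι] [PartialOrder α] {U : Set ℝ}
    {𝒮 : Finset (Finset ι)} {p : Finset ι → ι → ℝ} {A : Finset ι} {x : ι → ℝ} {f : Finset ι → α}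
    (hA𝒮 : A ∉ 𝒮) :
    OrderCompatible U (insert A 𝒮) (Function.update p A x) f ↔
      OrderCompatible U 𝒮 p f ∧ ∀ S ∈ 𝒮, ∀ i ∈ A, i ∈ S → (f A ≤ f S → p S i ≤ x i) ∧
        (f S ≤ f A → x i ≤ p S i) ∧ (x i = p S i → x i ∈ U → f A = f S) := by
  have hself : Function.update p A x A = x := Function.update_self A x p
  have hne : ∀ S ∈ 𝒮, Function.update p A x S = p S := fun S hS =>
    Function.update_of_ne (ne_of_mem_of_not_mem hS hA𝒮) x p
  have hA := Finset.mem_insert_self A 𝒮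
  have h𝒮 : ∀ S ∈ 𝒮, S ∈ insert A 𝒮 := fun S => Finset.mem_insert_of_mem
  constructor
  · refine fun h => ⟨⟨fun S hS T hT => ?_, fun S hS T hT => ?_⟩, fun S hS i hiA hiS => ⟨?_, ?_, ?_⟩⟩
    · simpa only [hne S hS, hne T hT] using h.antitone S (h𝒮 S hS) T (h𝒮 T hT)
    · simpa only [hne S hS, hne T hT] using h.eq_of_tie S (h𝒮 S hS) T (h𝒮 T hT)
    · simpa only [hne S hS, hself] using h.antitone A hA S (h𝒮 S hS) i hiA hiS
    · simpa only [hne S hS, hself] using h.antitone S (h𝒮 S hS) A hA i hiS hiA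
    · simpa only [hne S hS, hself] using h.eq_of_tie A hA S (h𝒮 S hS) i hiA hiS
  · rintro ⟨hdata, hnew⟩
    refine ⟨fun S hS T hT i hiS hiT => ?_, fun S hS T hT i hiS hiT => ?_⟩ <;>
      rcases Finset.mem_insert.1 hS with rfl | hS𝒮 <;> rcases Finset.mem_insert.1 hT with rfl | hT𝒮
    · exact fun _ => le_rfl
    · simpa only [hne T hT𝒮, hself] using (hnew T hT𝒮 i hiS hiT).1
    · simpa only [hne S hS𝒮, hself] using (hnew S hS𝒮 i hiT hiS).2.1
    · simpa only [hne S hS𝒮, hne T hT𝒮] using hdata.antitone S hS𝒮 T hT𝒮 i hiS hiT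
    · exact fun _ _ => rfl
    · simpa only [hne T hT𝒮, hself] using (hnew T hT𝒮 i hiS hiT).2.2
    · rw [hne S hS𝒮, hself]
      exact fun h hU => ((hnew S hS𝒮 i hiT hiS).2.2 h.symm (h ▸ hU)).symm
    · simpa only [hne S hS𝒮, hne T hT𝒮] using hdata.eq_of_tie S hS𝒮 T hT𝒮 i hiS hiT

lemma MILPFeasible.isProbVector {v : MILPVars n} (hv : MILPFeasible 𝒮 p A ε v) :
    IsProbVector A v.x := ⟨hv.x_nonneg, hv.sum_one⟩

lemma MILPFeasible.orderCompatible {v : MILPVars n} (hv : MILPFeasible 𝒮 p A ε v) (hε : 0 < ε) :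
    OrderCompatible {0}ᶜ 𝒮 p v.lam where
  antitone S hS T hT i hiS hiT hle := by
    by_contra! hlt
    linarith [hv.data_lt S hS T hT i hiS hiT hlt]
  eq_of_tie S hS T hT i hiS hiT htie hne := sub_eq_zero.1 (hv.data_eq S hS T hT i hiS hiT htie hne)

lemma MILPFeasible.orderCompatible_insert {v : MILPVars n} (hv : MILPFeasible 𝒮 p A ε v)
    (hε : 0 < ε) (hA𝒮 : A ∉ 𝒮) :
    OrderCompatible ∅ (insert A 𝒮) (Function.update p A v.x) v.lam := by
  refine (orderCompatible_insert_update_iff hA𝒮).2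
    ⟨(hv.orderCompatible hε).mono (empty_subset _), fun S hS i hiA hiS => ?_⟩
  have hAS := hv.sign_AS S hS i hiA hiS
  have hSA := hv.sign_SA S hS i hiA hiS
  have hord := hv.prob_order S hS i hiA hiS
  have htie := hv.prob_tie S hS i hiA hiS
  rcases hv.binary S hS with ⟨hdAS | hdAS, hdSA | hdSA⟩ <;>
    simp only [hdAS, hdSA] at hAS hSA hord htie <;>
    exact ⟨fun _ => by linarith, fun _ => by linarith, fun _ h => h.elim⟩

/-- The variables of the program as a point of a topological product space, in the order
`x`, `lam`, `dAS`, `dSA`. -/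
abbrev MILPPoint (n : ℕ) : Type :=
  (Fin n → ℝ) × (Finset (Fin n) → ℝ) × (Finset (Fin n) → ℝ) × (Finset (Fin n) → ℝ)

/-- The variables of the program read off a point of the product space. -/
def MILPPoint.toVars (q : MILPPoint n) : MILPVars n := ⟨q.1, q.2.1, q.2.2.1, q.2.2.2⟩

lemma isClosed_milpFeasible : IsClosed {q : MILPPoint n | MILPFeasible 𝒮 p A ε q.toVars} := by
  refine isClosed_of_closure_subset fun q₀ hq₀ => ?_
  have of_closed {P : MILPPoint n → Prop} (hP : IsClosed {q | P q})
      (h : ∀ q : MILPPoint n, MILPFeasible 𝒮 p A ε q.toVars → P q) : P q₀ :=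
    closure_minimal h hP hq₀
  have of_le {a b : MILPPoint n → ℝ}
      (h : ∀ q : MILPPoint n, MILPFeasible 𝒮 p A ε q.toVars → a q ≤ b q)
      (ha : Continuous a := by fun_prop) (hb : Continuous b := by fun_prop) : a q₀ ≤ b q₀ :=
    of_closed (isClosed_le ha hb) h
  have of_le_and_le {a b c : MILPPoint n → ℝ}
      (h : ∀ q : MILPPoint n, MILPFeasible 𝒮 p A ε q.toVars → a q ≤ b q ∧ b q ≤ c q)
      (ha : Continuous a := by fun_prop) (hb : Continuous b := by fun_prop)
      (hc : Continuous c := by fun_prop) : a q₀ ≤ b q₀ ∧ b q₀ ≤ c q₀ :=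
    ⟨of_le fun q hq => (h q hq).1, of_le fun q hq => (h q hq).2⟩
  have of_eq {a b : MILPPoint n → ℝ}
      (h : ∀ q : MILPPoint n, MILPFeasible 𝒮 p A ε q.toVars → a q = b q)
      (ha : Continuous a := by fun_prop) (hb : Continuous b := by fun_prop) : a q₀ = b q₀ :=
    of_closed (isClosed_eq ha hb) h
  have isClosed_binary {a : MILPPoint n → ℝ} (ha : Continuous a) :
      IsClosed {q | a q = 0 ∨ a q = 1} :=
    (isClosed_eq ha continuous_const).union (isClosed_eq ha continuous_const)
  exact
    { sign_AS := fun S hS i hiA hiS => of_le_and_le fun q hq => hq.sign_AS S hS i hiA hiS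
      sign_SA := fun S hS i hiA hiS => of_le_and_le fun q hq => hq.sign_SA S hS i hiA hiS
      prob_order := fun S hS i hiA hiS => of_le_and_le fun q hq => hq.prob_order S hS i hiA hiS
      prob_tie := fun S hS i hiA hiS => of_le_and_le fun q hq => hq.prob_tie S hS i hiA hiS
      data_lt := fun S hS T hT i hiS hiT h => of_le fun q hq => hq.data_lt S hS T hT i hiS hiT h
      data_eq := fun S hS T hT i hiS hiT h h0 => of_eq fun q hq =>
        hq.data_eq S hS T hT i hiS hiT h h0
      sum_one := of_eq fun q hq => hq.sum_one
      x_nonneg := fun i hi => of_le fun q hq => hq.x_nonneg i hi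
      lam_A := of_le_and_le fun q hq => hq.lam_A
      lam_S := fun S hS => of_le_and_le fun q hq => hq.lam_S S hS
      binary := fun S hS => of_closed
        ((isClosed_binary (by fun_prop)).inter (isClosed_binary (by fun_prop)))
        fun q hq => hq.binary S hS }

/-- The point of the program given by a choice vector `x` for `A` and levels `h`, with binary
variables recording the strict order of the levels. The entries of `x` outside `A` are set to `0`
so that the point lies in the unit box. -/
def levelPoint (A : Finset (Fin n)) (x : Fin n → ℝ) (h : Finset (Fin n) → ℝ) : MILPPoint n :=
  ((A : Set (Fin n)).indicator x, h, fun S => if h A < h S then 1 else 0,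
    fun S => if h S < h A then 1 else 0)

variable {h : Finset (Fin n) → ℝ}

lemma levelPoint_mem_Icc (hx : IsProbVector A x) (hh : ∀ S, h S ∈ Icc 0 1) :
    levelPoint A x h ∈ Icc 0 1 := by
  have hbin : ∀ (P : Prop) [Decidable P], (if P then (1 : ℝ) else 0) ∈ Icc 0 1 := fun P _ => by
    split_ifs <;> simp
  have hxmem : ∀ i, (A : Set (Fin n)).indicator x i ∈ Icc 0 1 := fun i => by
    by_cases hi : i ∈ A
    · simpa [hi] using ⟨hx.nonneg i hi, hx.le_one i hi⟩
    · simp [hi]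
  exact ⟨⟨fun i => (hxmem i).1, fun S => (hh S).1, fun S => (hbin _).1, fun S => (hbin _).1⟩,
    ⟨fun i => (hxmem i).2, fun S => (hh S).2, fun S => (hbin _).2, fun S => (hbin _).2⟩⟩

lemma revenue_levelPoint (r : Fin n → ℝ) : revenue r A (levelPoint A x h).1 = revenue r A x :=
  Finset.sum_congr rfl fun i hi => by simp [levelPoint, hi]

lemma neg_ite_le_sub_and_sub_le_ite {a b : ℝ} (ha : a ∈ Icc 0 1) (hb : b ∈ Icc 0 1)
    (hgap : a < b → a + ε ≤ b) :
    -(if a < b then (1 : ℝ) else 0) ≤ a - b ∧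
      a - b ≤ 1 - (1 + ε) * (if a < b then (1 : ℝ) else 0) := by
  obtain ⟨ha0, ha1⟩ := ha
  obtain ⟨hb0, hb1⟩ := hb
  split_ifs with hab
  · exact ⟨by linarith, by linarith [hgap hab]⟩
  · exact ⟨by linarith, by linarith⟩

lemma ite_sub_one_le_and_le_one_sub_ite {a b y : ℝ} (hy : y ∈ Icc (-1) 1) (hle : a ≤ b → 0 ≤ y)
    (hge : b ≤ a → y ≤ 0) :
    (if a < b then (1 : ℝ) else 0) - 1 ≤ y ∧ y ≤ 1 - (if b < a then (1 : ℝ) else 0) := by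
  obtain ⟨hy0, hy1⟩ := hy
  constructor
  · split_ifs with hab
    · linarith [hle hab.le]
    · linarith
  · split_ifs with hba
    · linarith [hge hba.le]
    · linarith

lemma neg_ite_add_ite_le_and_le {a b y : ℝ} (hy : y ∈ Icc (-1) 1) (hle : a ≤ b → 0 ≤ y)
    (hge : b ≤ a → y ≤ 0) :
    -((if a < b then (1 : ℝ) else 0) + if b < a then 1 else 0) ≤ y ∧
      y ≤ (if a < b then (1 : ℝ) else 0) + if b < a then 1 else 0 := by
  rcases lt_trichotomy a b with hab | rfl | hba
  · simpa [hab, hab.not_gt] using hy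
  · simpa using And.intro (hle le_rfl) (hge le_rfl)
  · simpa [hba, hba.not_gt] using hy

lemma milpFeasible_levelPoint (hA𝒮 : A ∉ 𝒮) (hp : ∀ S ∈ 𝒮, IsProbVector S (p S))
    (hx : IsProbVector A x) (hh : ∀ S, h S ∈ Icc 0 1)
    (hgap : ∀ S ∈ insert A 𝒮, ∀ T ∈ insert A 𝒮, h S < h T → h S + ε ≤ h T)
    (hord : OrderCompatible {0}ᶜ (insert A 𝒮) (Function.update p A x) h) :
    MILPFeasible 𝒮 p A ε (levelPoint A x h).toVars := by
  obtain ⟨hdata, hnew⟩ := (orderCompatible_insert_update_iff hA𝒮).1 hord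
  have hvx : ∀ i ∈ A, (levelPoint A x h).toVars.x i = x i := fun i hi =>
    indicator_of_mem (Finset.mem_coe.2 hi) x
  have hA := Finset.mem_insert_self A 𝒮
  have h𝒮 : ∀ S ∈ 𝒮, S ∈ insert A 𝒮 := fun S => Finset.mem_insert_of_mem
  have hdiff : ∀ S ∈ 𝒮, ∀ i ∈ A, i ∈ S → x i - p S i ∈ Icc (-1) 1 := fun S hS i hiA hiS =>
    ⟨by linarith [hx.nonneg i hiA, (hp S hS).le_one i hiS],
      by linarith [hx.le_one i hiA, (hp S hS).nonneg i hiS]⟩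
  have hle : ∀ S ∈ 𝒮, ∀ i ∈ A, i ∈ S → h A ≤ h S → 0 ≤ x i - p S i :=
    fun S hS i hiA hiS hAS => sub_nonneg.2 ((hnew S hS i hiA hiS).1 hAS)
  have hge : ∀ S ∈ 𝒮, ∀ i ∈ A, i ∈ S → h S ≤ h A → x i - p S i ≤ 0 :=
    fun S hS i hiA hiS hSA => sub_nonpos.2 ((hnew S hS i hiA hiS).2.1 hSA)
  refine ⟨fun S hS i _ _ => ?_, fun S hS i _ _ => ?_, fun S hS i hiA hiS => ?_,
    fun S hS i hiA hiS => ?_, fun S hS T hT i hiS hiT hlt => ?_,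
    fun S hS T hT i hiS hiT htie hne => ?_, ?_, fun i hi => ?_, hh A, fun S _ => hh S,
    fun S _ => ⟨?_, ?_⟩⟩
  · exact neg_ite_le_sub_and_sub_le_ite (hh A) (hh S) (hgap A hA S (h𝒮 S hS))
  · exact neg_ite_le_sub_and_sub_le_ite (hh S) (hh A) (hgap S (h𝒮 S hS) A hA)
  · exact (hvx i hiA).symm ▸ ite_sub_one_le_and_le_one_sub_ite
      (hdiff S hS i hiA hiS) (hle S hS i hiA hiS) (hge S hS i hiA hiS)
  · exact (hvx i hiA).symm ▸ neg_ite_add_ite_le_and_le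
      (hdiff S hS i hiA hiS) (hle S hS i hiA hiS) (hge S hS i hiA hiS)
  · have hlevel : h T < h S := lt_of_not_ge fun hle =>
      hlt.not_ge (hdata.antitone S hS T hT i hiS hiT hle)
    exact le_sub_iff_add_le'.2 (hgap T (h𝒮 T hT) S (h𝒮 S hS) hlevel)
  · exact sub_eq_zero.2 (hdata.eq_of_tie S hS T hT i hiS hiT htie hne)
  · exact (Finset.sum_congr rfl hvx).trans hx.sum_eq_one
  · exact (hx.nonneg i hi).trans_eq (hvx i hi).symm
  · exact (ite_eq_or_eq _ _ _).symm
  · exact (ite_eq_or_eq _ _ _).symm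

/-- The expected revenues of the feasible points of the program in the unit box. The box makes
them a compact set, since it also confines the variables that no constraint mentions. -/
def milpBoxValues (𝒮 : Finset (Finset (Fin n))) (p : Finset (Fin n) → Fin n → ℝ)
    (A : Finset (Fin n)) (r : Fin n → ℝ) (ε : ℝ) : Set ℝ :=
  (fun q : MILPPoint n => revenue r A q.1) '' (Icc 0 1 ∩ {q | MILPFeasible 𝒮 p A ε q.toVars})

variable {r : Fin n → ℝ}

lemma isCompact_milpBoxValues : IsCompact (milpBoxValues 𝒮 p A r ε) :=
  (isCompact_Icc.inter_right isClosed_milpFeasible).image (by unfold revenue; fun_prop)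

lemma milpBoxValues_subset_milpValues : milpBoxValues 𝒮 p A r ε ⊆ milpValues 𝒮 p A r ε := by
  rintro _ ⟨q, ⟨-, hq⟩, rfl⟩
  exact ⟨q.toVars, hq, rfl⟩

lemma consistentRevenues_subset_milpBoxValues (hp : ∀ S ∈ 𝒮, IsProbVector S (p S)) (hA𝒮 : A ∉ 𝒮)
    (hε : 0 < ε) (hε𝒮 : ε * 𝒮.card ≤ 1) :
    consistentRevenues 𝒮 p A r ⊆ milpBoxValues 𝒮 p A r ε := by
  rintro _ ⟨x, hx, rfl⟩
  have hxA : IsProbVector A x := by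
    simpa using mdmProbs.isProbVector hx (Finset.mem_insert_self A 𝒮)
  obtain ⟨f, hf⟩ := mdmProbs.exists_orderCompatible hx
  obtain ⟨h, hh, hgap, hord⟩ :=
    hf.exists_unitInterval_levels hε (Finset.card_insert_le A 𝒮) hε𝒮
  exact ⟨levelPoint A x h,
    ⟨levelPoint_mem_Icc hxA hh, milpFeasible_levelPoint hA𝒮 hp hxA hh hgap hord⟩,
    revenue_levelPoint r⟩

lemma milpValues_subset_closure (hp : ∀ S ∈ 𝒮, IsProbVector S (p S)) (hA𝒮 : A ∉ 𝒮)
    (hε : 0 < ε) : milpValues 𝒮 p A r ε ⊆ closure (consistentRevenues 𝒮 p A r) := by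
  rintro _ ⟨v, hv, rfl⟩
  have hv : MILPFeasible 𝒮 p A ε v := hv
  exact revenue_mem_closure_consistentRevenues hp hA𝒮 (hv.orderCompatible hε) hv.isProbVector
    (hv.orderCompatible_insert hε hA𝒮) r

lemma closure_consistentRevenues_eq_milpValues (hp : ∀ S ∈ 𝒮, IsProbVector S (p S))
    (hA𝒮 : A ∉ 𝒮) (hε : 0 < ε) (hε𝒮 : ε * 𝒮.card ≤ 1) :
    closure (consistentRevenues 𝒮 p A r) = milpValues 𝒮 p A r ε :=
  ((closure_minimal (consistentRevenues_subset_milpBoxValues hp hA𝒮 hε hε𝒮)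
    isCompact_milpBoxValues.isClosed).trans milpBoxValues_subset_milpValues).antisymm
    (milpValues_subset_closure hp hA𝒮 hε)

lemma consistentRevenues_nonempty (hp : p ∈ mdmProbs 𝒮) (hA : A.Nonempty) (hA𝒮 : A ∉ 𝒮) :
    (consistentRevenues 𝒮 p A r).Nonempty := by
  obtain ⟨f, hf⟩ := mdmProbs.exists_orderCompatible hp
  have hprob : ∀ S ∈ 𝒮, IsProbVector S (p S) := fun S => mdmProbs.isProbVector hp
  obtain ⟨h, -, -, hord⟩ := hf.exists_unitInterval_levels (ε := (𝒮.card + 1 : ℝ)⁻¹) (by positivity)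
    (Nat.le_succ _) (by rw [inv_mul_le_iff₀ (by positivity)]; linarith)
  obtain ⟨μ, hμ, hfit, hone⟩ := (hord.mono fun _ h => h.1.ne').exists_marginals
    fun S hS i hi => ⟨(hprob S hS).nonneg i hi, (hprob S hS).le_one i hi⟩
  obtain ⟨l, hl⟩ := exists_sum_survival_eq_one (ν := 0) hμ hone hA
  exact ⟨_, mem_image_of_mem _ (survival_mem_consistentChoices hprob hA hA𝒮 hμ hfit hl)⟩

end Program

theorem proposition2_general {n : ℕ} (𝒮 : Finset (Finset (Fin n)))
    (p : Finset (Fin n) → Fin n → ℝ) (hp : p ∈ mdmProbs 𝒮)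
    (A : Finset (Fin n)) (hA : A.Nonempty) (hA𝒮 : A ∉ 𝒮)
    (r : Fin n → ℝ) (ε : ℝ) (hε : 0 < ε) (hε𝒮 : ε * 𝒮.card ≤ 1) :
    ((consistentRevenues 𝒮 p A r).Nonempty ∧ BddBelow (consistentRevenues 𝒮 p A r) ∧
      BddAbove (consistentRevenues 𝒮 p A r)) ∧
    IsLeast (milpValues 𝒮 p A r ε) (worstCaseRevenue 𝒮 p A r) ∧
    IsGreatest (milpValues 𝒮 p A r ε) (optimisticRevenue 𝒮 p A r) := by
  have hprob : ∀ S ∈ 𝒮, IsProbVector S (p S) := fun S => mdmProbs.isProbVector hp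
  have hne : (consistentRevenues 𝒮 p A r).Nonempty := consistentRevenues_nonempty hp hA hA𝒮
  have hsub : consistentRevenues 𝒮 p A r ⊆ milpBoxValues 𝒮 p A r ε :=
    consistentRevenues_subset_milpBoxValues hprob hA𝒮 hε hε𝒮
  have hbelow := isCompact_milpBoxValues.bddBelow.mono hsub
  have habove := isCompact_milpBoxValues.bddAbove.mono hsub
  rw [← closure_consistentRevenues_eq_milpValues hprob hA𝒮 hε hε𝒮]
  refine ⟨⟨hne, hbelow, habove⟩, ⟨csInf_mem_closure hne hbelow, ?_⟩,
    ⟨csSup_mem_closure hne habove, ?_⟩⟩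
  · rw [lowerBounds_closure]
    exact (isGLB_csInf hne hbelow).1
  · rw [upperBounds_closure]
    exact (isLUB_csSup hne habove).1

theorem proposition2 {n : ℕ} (𝒮 : Finset (Finset (Fin n)))
    (p : Finset (Fin n) → Fin n → ℝ) (hp : p ∈ mdmProbs 𝒮)
    (A : Finset (Fin n)) (hA : A.Nonempty) (hA𝒮 : A ∉ 𝒮)
    (r : Fin n → ℝ) (hr : ∀ i, 0 < r i)
    (ε : ℝ) (hε : 0 < ε) (hε' : ε * (2 * (𝒮.card : ℝ)) < 1) :
    -- the infimum and the supremum that define the two revenues are proper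
    ((consistentRevenues 𝒮 p A r).Nonempty ∧ BddBelow (consistentRevenues 𝒮 p A r) ∧
      BddAbove (consistentRevenues 𝒮 p A r)) ∧
    -- they are the minimum and the maximum of the program
    IsLeast (milpValues 𝒮 p A r ε) (worstCaseRevenue 𝒮 p A r) ∧
    IsGreatest (milpValues 𝒮 p A r ε) (optimisticRevenue 𝒮 p A r) :=
  proposition2_general 𝒮 p hp A hA hA𝒮 r ε hε
    (by linarith [mul_nonneg hε.le (Nat.cast_nonneg (α := ℝ) 𝒮.card)])

end
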